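/- Let $A\subset\mathbb{Z}^d$ be a finite set whose convex hull is full dimensional, and let $f=\bigoplus_{i\in A}p_i\odot w^i$ be a tropical polynomial with support $A$ and coefficients $p_i\in\mathbb{R}$, i.e. $f(w)=\min_{i\in A}(p_i+\langle i,w\rangle)$; its tropical hypersurface $\mathcal{T}(f)\subset\mathbb{R}^d$ is the set of points at which this minimum is attained at least twice. Let $\mathbb{K}$ be an algebraically closed field of characteristic $0$ with a nontrivial valuation $val:\mathbb{K}^*\to\mathbb{R}$ whose residue field has characteristic $0$, and let $\Gamma=val(\mathbb{K}^*)$. A point $q\in\mathcal{T}(f)$ is singular if there are $F=\sum_{i\in A}a_ix^i\in\mathbb{K}[x_1^{\pm1},\dots,x_d^{\pm1}]$ with $val(a_i)=p_i$ and $b\in(\mathbb{K}^*)^d$ with $val(b)=q$ such that $F$ and all its partial derivatives vanish at $b$. Write $\langle S\rangle$ for the real affine span of $S$. The flag of $f$ at $q\in\mathcal{T}(f)$ is $F_0(q)\subsetneq F_1(q)\subsetneq\dots\subsetneq F_r(q)$, where $F_0(q)$ is the set of $i\in A$ at which $f(q)$ is attained, $F_{\ell+1}(q)\setminus F_\ell(q)$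 is the set of $i\in A\setminus\langle F_\ell(q)\rangle$ at which $\bigoplus_{i\in A\setminus\langle F_\ell(q)\rangle}p_i\odot w^i$ attains its minimum at $q$, and $r$ is the first index with $\dim\langle F_r(q)\rangle=d$. A weight class of $f$ is the set of all $q'\in\mathcal{T}(f)$ with the same flag as a given $q\in\mathcal{T}(f)$. For a marked cell $\sigma$ of the coherent marked subdivision $\Pi_p$ of $A$ induced by $p$, the dual cell $\sigma^*$ is the closure of the set of points at which the minimum of $f$ is attained exactly on $\sigma$; the cells $\sigma^*$ with $|\sigma|\ge2$ are the cells of $\mathcal{T}(f)$. For an integral affine function $L$ let $\partial f/\partial L=\bigoplus_{i\in A,\,L(i)\ne0}p_i\odot w^i$. The algorithm at a point $q\in\mathcal{T}(f)$ proceeds as follows, starting with $\ell=0$: compute $F_\ell=F_\ell(q)$; if $F_\ell$ is a pyramid, i.e. there is $i\in F_\ell$ with $i\notin\langle F_\ell\setminus\{i\}\rangle$, choose such an $i$ and return an integral affine function $L$ that vanishes on $F_\ell\setminus\{i\}$ with $L(i)\neq0$; otherwise, if $\dim\langle F_\ell\rangle=d$, return "$q$ is a singular point", and if $\dim\langle F_\ell\rangle<d$,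 continue with $\ell+1$. Proposition. (1) Every flag is strictly increasing and reaches a set of affine dimension $d$. There are finitely many weight classes, each is a relatively open polyhedral cell (the relative interior of its closure, which is a polyhedron with integral normal vectors), and their closures form a polyhedral complex with support $\mathcal{T}(f)$ which refines the structure given by the cells $\sigma^*$ dual to $\Pi_p$: each closed weight class lies in some $\sigma^*$, each $\sigma^*$ is a union of closed weight classes, and the weight class of $q$ lies in the relative interior of $F_0(q)^*$. (2) Suppose that $p_i\in\Gamma$ for all $i\in A$, and let $C$ be a weight class. Then either all points of $C$ with coordinates in $\Gamma$ are singular (all points of $C$, when $\Gamma=\mathbb{R}$), or no point of $C$ is singular. The algorithm, applied to any point $q\in C$, terminates. If it returns "$q$ is a singular point", then all points of $C$ with coordinates in $\Gamma$ are singular; if it returns $L$, then no point of $C$ is singular, $\partial f/\partial L$ is a nonzero tropical polynomial (i.e. $L(i)\neq0$ for some $i\in A$), and $q\notin\mathcal{T}(\partial f/\partial L)$. -/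

import Mathlib

noncomputable section

namespace TropSing

open Classical

/-! ### Tropical polynomials with support in a lattice set -/

/-- A lattice point regarded as a point of `ℝ^d`. -/
def toReal {d : ℕ} (i : Fin d → ℤ) : Fin d → ℝ := fun k => (i k : ℝ)

/-- The linear form `⟨i, w⟩ = i₁ w₁ + ⋯ + i_d w_d`. -/
def pair {d : ℕ} (i : Fin d → ℤ) (w : Fin d → ℝ) : ℝ := ∑ k, (i k : ℝ) * w k

/-- The value at `w` of the tropical monomial `p_i ⊙ w^i`. -/
def term {d : ℕ} (p : (Fin d → ℤ) → ℝ) (i : Fin d → ℤ) (w : Fin d → ℝ) : ℝ :=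
  p i + pair i w

/-- The set of exponents in `S` at which the tropical polynomial `⨁_{i ∈ S} p_i ⊙ w^i` attains its
minimum at `w`. -/
def minimizers {d : ℕ} (S : Finset (Fin d → ℤ)) (p : (Fin d → ℤ) → ℝ) (w : Fin d → ℝ) :
    Finset (Fin d → ℤ) :=
  S.filter fun i => ∀ j ∈ S, term p i w ≤ term p j w

/-- The tropical hypersurface of `⨁_{i ∈ S} p_i ⊙ w^i` (for nonempty `S`): the minimum is attained
at two different exponents at least. -/
def tropHypersurface {d : ℕ} (S : Finset (Fin d → ℤ)) (p : (Fin d → ℤ) → ℝ) :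
    Set (Fin d → ℝ) :=
  {w | ∃ i₁ ∈ minimizers S p w, ∃ i₂ ∈ minimizers S p w, i₁ ≠ i₂}

/-! ### Affine spans of sets of lattice points -/

/-- The real affine span `⟨S⟩` of a set of lattice points. -/
def span {d : ℕ} (S : Finset (Fin d → ℤ)) : AffineSubspace ℝ (Fin d → ℝ) :=
  affineSpan ℝ (toReal '' (S : Set (Fin d → ℤ)))

/-- The dimension of the real affine span. -/
def affDim {d : ℕ} (S : Finset (Fin d → ℤ)) : ℕ := Module.finrank ℝ (span S).direction

/-- A configuration is a pyramid if one of its points is not in the affine span of the others. -/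
def IsPyramid {d : ℕ} (S : Finset (Fin d → ℤ)) : Prop :=
  ∃ i ∈ S, toReal i ∉ span (S.erase i)

/-! ### Integral affine functions and Euler derivatives -/

/-- An integral affine function `L(w) = j₁ w₁ + ⋯ + j_d w_d + β`. -/
structure IntAffine (d : ℕ) where
  lin : Fin d → ℤ
  const : ℤ

/-- The value of an integral affine function at a lattice point. -/
def IntAffine.eval {d : ℕ} (L : IntAffine d) (i : Fin d → ℤ) : ℤ :=
  (∑ k, L.lin k * i k) + L.const

/-- The support `{i ∈ A : L(i) ≠ 0}` of the Euler derivative `∂f/∂L`, whose coefficients are those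
of `f`. -/
def eulerSupport {d : ℕ} (A : Finset (Fin d → ℤ)) (L : IntAffine d) : Finset (Fin d → ℤ) :=
  A.filter fun i => L.eval i ≠ 0

/-! ### Flags and weight classes -/

/-- The exponents in `A` that are not in the affine span of `F`. -/
def outside {d : ℕ} (A F : Finset (Fin d → ℤ)) : Finset (Fin d → ℤ) :=
  A.filter fun i => toReal i ∉ span F

/-- From `F_ℓ(q)` to `F_{ℓ+1}(q)`: add the exponents at which `⨁_{i ∈ A - ⟨F_ℓ⟩} p_i ⊙ w^i`
attains its minimum at `q`. -/
def nextStep {d : ℕ} (A : Finset (Fin d → ℤ)) (p : (Fin d → ℤ) → ℝ) (q : Fin d → ℝ)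
    (F : Finset (Fin d → ℤ)) : Finset (Fin d → ℤ) :=
  F ∪ minimizers (outside A F) p q

/-- The flag `F_0(q) ⊊ F_1(q) ⊊ ⋯ ⊊ F_r(q)` of `f` at `q`. It is written as an infinite sequence,
which is constant from the index `r` on at which the affine span has become everything. -/
def flag {d : ℕ} (A : Finset (Fin d → ℤ)) (p : (Fin d → ℤ) → ℝ) (q : Fin d → ℝ) :
    ℕ → Finset (Fin d → ℤ)
  | 0 => minimizers A p q
  | ℓ + 1 => nextStep A p q (flag A p q ℓ)

/-- The weight class of the flag of `f` at `q`. -/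
def weightClass {d : ℕ} (A : Finset (Fin d → ℤ)) (p : (Fin d → ℤ) → ℝ) (q : Fin d → ℝ) :
    Set (Fin d → ℝ) :=
  {q' | q' ∈ tropHypersurface A p ∧ flag A p q' = flag A p q}

/-- The collection of all weight classes of `f`. -/
def weightClasses {d : ℕ} (A : Finset (Fin d → ℤ)) (p : (Fin d → ℤ) → ℝ) :
    Set (Set (Fin d → ℝ)) :=
  {C | ∃ q ∈ tropHypersurface A p, C = weightClass A p q}

/-! ### The coherent marked subdivision and its dual polyhedral structure -/

/-- The marked cells of the coherent marked subdivision `Π_p`: the nonempty sets of exponents in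
`A` at which an affine function `φ(x) = ⟨x, u⟩ + β` lying below the lifted points `(i, p_i)`
touches them. -/
def markedSubdivision {d : ℕ} (A : Finset (Fin d → ℤ)) (p : (Fin d → ℤ) → ℝ) :
    Set (Finset (Fin d → ℤ)) :=
  {σ | σ.Nonempty ∧ ∃ (u : Fin d → ℝ) (β : ℝ), (∀ i ∈ A, pair i u + β ≤ p i) ∧
    σ = A.filter fun i => p i = pair i u + β}

/-- The cell `σ^*` dual to a marked cell `σ`: the closure of the set of points at which the minimum
of `f` is attained exactly at `σ`. -/
def dualCell {d : ℕ} (A : Finset (Fin d → ℤ)) (p : (Fin d → ℤ) → ℝ)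
    (σ : Finset (Fin d → ℤ)) : Set (Fin d → ℝ) :=
  closure {q | minimizers A p q = σ}

/-- The cells of `T(f)` in the polyhedral structure dual to `Π_p` (the marked cells that consist of
one exponent only are dual to the components of the complement of `T(f)`). -/
def hypersurfaceCells {d : ℕ} (A : Finset (Fin d → ℤ)) (p : (Fin d → ℤ) → ℝ) :
    Set (Set (Fin d → ℝ)) :=
  {P | ∃ σ ∈ markedSubdivision A p, 2 ≤ σ.card ∧ P = dualCell A p σ}

/-! ### Polyhedra and polyhedral complexes -/

/-- A polyhedron with integral normal vectors: a finite intersection of closed half spaces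
`{q : ⟨u, q⟩ ≤ c}` with `u ∈ ℤ^d` and `c ∈ ℝ`. -/
def IsRationalPolyhedron {d : ℕ} (P : Set (Fin d → ℝ)) : Prop :=
  ∃ S : Finset ((Fin d → ℤ) × ℝ), P = {q | ∀ s ∈ S, pair s.1 q ≤ s.2}

/-- A relatively open polyhedral cell: the relative interior of a polyhedron. -/
def IsRelOpenCell {d : ℕ} (C : Set (Fin d → ℝ)) : Prop :=
  ∃ P, IsRationalPolyhedron P ∧ C = intrinsicInterior ℝ P

/-- A finite polyhedral complex, given by the set of its nonempty cells. Faces are exposed faces,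
and two cells meet in a common face, which may be empty. -/
structure IsPolyhedralComplex {d : ℕ} (𝒦 : Set (Set (Fin d → ℝ))) : Prop where
  finite : 𝒦.Finite
  nonempty : ∀ P ∈ 𝒦, P.Nonempty
  polyhedron : ∀ P ∈ 𝒦, IsRationalPolyhedron P
  face_mem : ∀ P ∈ 𝒦, ∀ G : Set (Fin d → ℝ), G.Nonempty → IsExposed ℝ P G → G ∈ 𝒦
  inter_left : ∀ P ∈ 𝒦, ∀ Q ∈ 𝒦, IsExposed ℝ P (P ∩ Q)
  inter_right : ∀ P ∈ 𝒦, ∀ Q ∈ 𝒦, IsExposed ℝ Q (P ∩ Q)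

/-- `𝒦'` refines `𝒦`: each cell of `𝒦'` is contained in a cell of `𝒦`, and each cell of `𝒦` is the
union of the cells of `𝒦'` contained in it. -/
def Refines {d : ℕ} (𝒦' 𝒦 : Set (Set (Fin d → ℝ))) : Prop :=
  (∀ P ∈ 𝒦', ∃ Q ∈ 𝒦, P ⊆ Q) ∧ ∀ Q ∈ 𝒦, Q = ⋃₀ {P | P ∈ 𝒦' ∧ P ⊆ Q}

/-! ### Singular points -/

/-- The value at `x` (with nonzero coordinates) of the Laurent polynomial `F = ∑_{i ∈ A} a_i x^i`. -/
def laurentEval {d : ℕ} {K : Type*} [Field K] (A : Finset (Fin d → ℤ)) (a : (Fin d → ℤ) → K)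
    (x : Fin d → K) : K :=
  ∑ i ∈ A, a i * ∏ k, x k ^ i k

/-- The value at `x` of the partial derivative `∂F/∂x_j = ∑_{i ∈ A} i_j a_i x^{i - e_j}`. -/
def laurentPDeriv {d : ℕ} {K : Type*} [Field K] (A : Finset (Fin d → ℤ)) (a : (Fin d → ℤ) → K)
    (j : Fin d) (x : Fin d → K) : K :=
  ∑ i ∈ A, (i j : K) * a i * ∏ k, x k ^ (i k - if k = j then 1 else 0)

/-- `q ∈ T(f)` is a singular point: there are a Laurent polynomial `F = ∑_{i ∈ A} a_i x^i` with
`val(a_i) = p_i` and a singular point `b` of `V(F)` in the torus with `val(b) = q`. The values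
`p_i` and `q_k` are finite, so that all `a_i` and `b_k` are nonzero. -/
def IsSingularPoint {d : ℕ} {K : Type*} [Field K] (v : AddValuation K (WithTop ℝ))
    (A : Finset (Fin d → ℤ)) (p : (Fin d → ℤ) → ℝ) (q : Fin d → ℝ) : Prop :=
  q ∈ tropHypersurface A p ∧
  ∃ (a : (Fin d → ℤ) → K) (b : Fin d → K),
    (∀ i ∈ A, v (a i) = (p i : WithTop ℝ)) ∧ (∀ k, v (b k) = (q k : WithTop ℝ)) ∧
    laurentEval A a b = 0 ∧ ∀ j, laurentPDeriv A a j b = 0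

/-! ### The algorithm -/

/-- `RunFrom A p q F out`: the procedure at the point `q`, after it has computed the member `F` of
the flag, can end with the answer `out`. The answer `some L` is a certificate that `q` is regular;
the answer `none` is "`q` is a singular point". If `F` is a pyramid, then a point `i ∈ F` that is
not in `⟨F - {i}⟩` is chosen, and any `L` that defines the facet `⟨F - {i}⟩` of `F` may be
returned. If not, the procedure stops with `none` when `F` spans an affine space of dimension `d`,
and it computes the next member of the flag and goes on otherwise. -/
inductive RunFrom {d : ℕ} (A : Finset (Fin d → ℤ)) (p : (Fin d → ℤ) → ℝ) (q : Fin d → ℝ) :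
    Finset (Fin d → ℤ) → Option (IntAffine d) → Prop
  | regular (F : Finset (Fin d → ℤ)) (i : Fin d → ℤ) (L : IntAffine d) (hi : i ∈ F)
      (hspan : toReal i ∉ span (F.erase i)) (hzero : ∀ j ∈ F.erase i, L.eval j = 0)
      (hne : L.eval i ≠ 0) : RunFrom A p q F (some L)
  | singular (F : Finset (Fin d → ℤ)) (hF : ¬ IsPyramid F) (hdim : affDim F = d) :
      RunFrom A p q F none
  | step (F : Finset (Fin d → ℤ)) (out : Option (IntAffine d)) (hF : ¬ IsPyramid F)
      (hdim : affDim F < d) (hrun : RunFrom A p q (nextStep A p q F) out) : RunFrom A p q F out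

/-- `AlgorithmReturns A p q out`: the algorithm, started at `q` with `F_0(q)`, can end with the
answer `out`. -/
def AlgorithmReturns {d : ℕ} (A : Finset (Fin d → ℤ)) (p : (Fin d → ℤ) → ℝ) (q : Fin d → ℝ)
    (out : Option (IntAffine d)) : Prop :=
  RunFrom A p q (minimizers A p q) out

end TropSing

end

noncomputable section

namespace TropSing

open Classical

/-! ### Polyhedra cut out by comparisons of tropical monomials -/

section Polyhedra

variable {d : ℕ} {p : (Fin d → ℤ) → ℝ} {R : Finset ((Fin d → ℤ) × (Fin d → ℤ))}
  {i j : Fin d → ℤ} {q x y : Fin d → ℝ}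

/-! Polyhedral structure. A flag is determined by comparisons of tropical monomials. The pairs (i,
j) in `flagRel A p q` are exactly the comparisons used to compute the flag at q: i is a minimizer on
some A - ⟨F_ℓ⟩ and j is any member of that set. Sharing the flag of q means satisfying the same
inequalities with the same equalities (`weightClass_eq_relCell`), so a weight class is the relative
interior of a polyhedron. For q' in that polyhedron, the polyhedron of the flag at q' is a face of
it (`relPoly_flagRel_eq_relFace`), and this gives a complex.

Singularity. With y_i = a_i b^i, F and its partial derivatives vanish at b iff ∑ y_i (1, i) = 0, and
v(y_i) is the value of the i-th monomial at q. So a point is singular only if some affine relation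
on A has these prescribed valuations, and the converse holds when the coordinates of q lie in the
value group. If some member of the flag is a pyramid, take the first one, with apex i and L
vanishing on the rest. Then i is the unique minimizer of ∂f/∂L
(`exists_unique_min_of_algorithmReturns_some`). Nonzero integers have valuation 0 because the
residue characteristic is 0, so ∑ L(i) y_i = 0 is impossible. If no member is a pyramid, every
exponent j is a rational affine combination of other exponents of at most the same value. Rational
numbers have nonnegative valuation, so a multiple of this dependency has the right valuation at j
and is large enough elsewhere (`exists_relation_of_mem_span`). A generic combination with natural
coefficients is right everywhere (`exists_relation_of_forall_exists`). The run of the algorithm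
depends on the flag only, so its answers hold for the whole class. -/

lemma pair_lineMap (i : Fin d → ℤ) (x y : Fin d → ℝ) (t : ℝ) :
    pair i (AffineMap.lineMap x y t) = (1 - t) * pair i x + t * pair i y := by
  simp only [pair, AffineMap.lineMap_apply_module, Finset.mul_sum, ← Finset.sum_add_distrib,
    Pi.add_apply, Pi.smul_apply, smul_eq_mul]
  exact Finset.sum_congr rfl fun k _ => by ring

lemma term_lineMap (p : (Fin d → ℤ) → ℝ) (i : Fin d → ℤ) (x y : Fin d → ℝ) (t : ℝ) :
    term p i (AffineMap.lineMap x y t) = (1 - t) * term p i x + t * term p i y := by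
  rw [term, pair_lineMap, term, term]; ring

lemma continuous_term (p : (Fin d → ℤ) → ℝ) (i : Fin d → ℤ) : Continuous (term p i) := by
  unfold term pair; fun_prop

lemma pair_sub (i j : Fin d → ℤ) (x : Fin d → ℝ) : pair (i - j) x = pair i x - pair j x := by
  simp only [pair, ← Finset.sum_sub_distrib]
  exact Finset.sum_congr rfl fun k _ => by simp; ring

/-- The polyhedron of the points at which `p_i ⊙ w^i ≤ p_j ⊙ w^j` for all `(i, j) ∈ R`. -/
def relPoly (p : (Fin d → ℤ) → ℝ) (R : Finset ((Fin d → ℤ) × (Fin d → ℤ))) :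
    Set (Fin d → ℝ) :=
  {x | ∀ r ∈ R, term p r.1 x ≤ term p r.2 x}

/-- The inequalities of `relPoly p R` that are equalities at `x`. -/
def tight (p : (Fin d → ℤ) → ℝ) (R : Finset ((Fin d → ℤ) × (Fin d → ℤ))) (x : Fin d → ℝ) :
    Finset ((Fin d → ℤ) × (Fin d → ℤ)) :=
  R.filter fun r => term p r.1 x = term p r.2 x

/-- The points of `relPoly p R` at which exactly the inequalities in `t` are tight. -/
def relCell (p : (Fin d → ℤ) → ℝ) (R t : Finset ((Fin d → ℤ) × (Fin d → ℤ))) :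
    Set (Fin d → ℝ) :=
  {x | x ∈ relPoly p R ∧ tight p R x = t}

/-- The points of `relPoly p R` at which the inequalities in `t` are tight. -/
def relFace (p : (Fin d → ℤ) → ℝ) (R t : Finset ((Fin d → ℤ) × (Fin d → ℤ))) :
    Set (Fin d → ℝ) :=
  {x | x ∈ relPoly p R ∧ t ⊆ tight p R x}

lemma mem_tight {r : (Fin d → ℤ) × (Fin d → ℤ)} :
    r ∈ tight p R x ↔ r ∈ R ∧ term p r.1 x = term p r.2 x := by
  simp [tight]

lemma relCell_subset_relFace (t : Finset ((Fin d → ℤ) × (Fin d → ℤ))) :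
    relCell p R t ⊆ relFace p R t := fun _ hx => ⟨hx.1, hx.2.ge⟩

lemma tight_subset_iff :
    tight p R q ⊆ tight p R x ↔
      ∀ r ∈ R, term p r.1 q = term p r.2 q → term p r.1 x = term p r.2 x := by
  constructor
  · exact fun h r hr e => (mem_tight.1 (h (mem_tight.2 ⟨hr, e⟩))).2
  · exact fun h r hr => mem_tight.2 ⟨(mem_tight.1 hr).1, h r (mem_tight.1 hr).1 (mem_tight.1 hr).2⟩

lemma mem_relCell_iff :
    x ∈ relCell p R (tight p R q) ↔ ∀ r ∈ R, term p r.1 x ≤ term p r.2 x ∧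
      (term p r.1 x = term p r.2 x ↔ term p r.1 q = term p r.2 q) := by
  constructor
  · rintro ⟨h, e⟩ r hr
    refine ⟨h r hr, ?_⟩
    have := congrArg (r ∈ ·) e
    simpa [mem_tight, hr] using this
  · intro h
    refine ⟨fun r hr => (h r hr).1, ?_⟩
    ext r
    rw [mem_tight, mem_tight]
    exact and_congr_right fun hr => (h r hr).2

lemma isClosed_relPoly : IsClosed (relPoly p R) := by
  have : relPoly p R = ⋂ r ∈ R, {x | term p r.1 x ≤ term p r.2 x} := by
    ext x; simp [relPoly]
  rw [this]
  exact isClosed_biInter fun r _ => isClosed_le (continuous_term p _) (continuous_term p _)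

lemma relFace_eq_relPoly (t : Finset ((Fin d → ℤ) × (Fin d → ℤ))) (ht : t ⊆ R) :
    relFace p R t = relPoly p (R ∪ t.image Prod.swap) := by
  ext x
  constructor
  · rintro ⟨hx, h⟩ r hr
    rcases Finset.mem_union.1 hr with hr | hr
    · exact hx r hr
    · obtain ⟨s, hs, rfl⟩ := Finset.mem_image.1 hr
      exact (mem_tight.1 (h hs)).2.ge
  · intro h
    have h1 : x ∈ relPoly p R := fun r hr => h r (Finset.mem_union_left _ hr)
    exact ⟨h1, fun r hr => mem_tight.2 ⟨ht hr, le_antisymm (h1 r (ht hr))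
      (h r.swap (Finset.mem_union_right _ (Finset.mem_image_of_mem _ hr)))⟩⟩

lemma tight_subset : tight p R x ⊆ R := Finset.filter_subset _ _

lemma isClosed_relFace_tight : IsClosed (relFace p R (tight p R q)) := by
  rw [relFace_eq_relPoly _ tight_subset]; exact isClosed_relPoly

lemma isRationalPolyhedron_relPoly : IsRationalPolyhedron (relPoly p R) := by
  refine ⟨R.image fun r => (r.1 - r.2, p r.2 - p r.1), ?_⟩
  ext x
  simp only [relPoly, Set.mem_ofPred_eq, Finset.mem_image, forall_exists_index, and_imp,
    forall_apply_eq_imp_iff₂, pair_sub, term]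
  exact forall₂_congr fun r _ => by constructor <;> intro h <;> linarith

/-! ### Closures and relative interiors of faces -/

/-- A point at which at most the inequalities tight at `x` are tight can be moved away from `x`
inside the polyhedron. -/
lemma exists_extension (hq : q ∈ relPoly p R) (h : tight p R q ⊆ tight p R x) :
    ∃ ε : ℝ, 0 < ε ∧ AffineMap.lineMap x q (1 + ε) ∈ relPoly p R := by
  -- Inequalities tight at `q` are tight at `x` too, hence on the whole line. The others are strict
  -- at `q` and survive a small move.
  have key : ∀ᶠ ε : ℝ in nhdsWithin 0 (Set.Ioi 0), ∀ r ∈ R,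
      term p r.1 (AffineMap.lineMap x q (1 + ε)) ≤ term p r.2 (AffineMap.lineMap x q (1 + ε)) := by
    rw [Filter.eventually_all_finset]
    intro r hr
    by_cases e : term p r.1 q = term p r.2 q
    · have e' := tight_subset_iff.1 h r hr e
      exact Filter.Eventually.of_forall fun ε => by rw [term_lineMap, term_lineMap, e, e']
    · have hlt := lt_of_le_of_ne (hq r hr) e
      apply Filter.Eventually.filter_mono nhdsWithin_le_nhds
      have c : ∀ i, Continuous fun ε : ℝ => term p i (AffineMap.lineMap x q (1 + ε)) := by
        intro i
        simp only [term_lineMap]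
        fun_prop
      have := (c r.1).continuousAt.eventually_lt (c r.2).continuousAt (x₀ := 0) (by simpa using hlt)
      exact this.mono fun _ h => h.le
  obtain ⟨ε, h1, h2⟩ := (key.and self_mem_nhdsWithin).exists
  exact ⟨ε, h2, h1⟩

/-- On the segment, `q` has positive weight, so whatever is strict at `q` stays strict. -/
lemma lineMap_mem_relCell (hq : q ∈ relPoly p R) (hx : x ∈ relFace p R (tight p R q)) {t : ℝ}
    (h0 : 0 < t) (h1 : t ≤ 1) : AffineMap.lineMap x q t ∈ relCell p R (tight p R q) := by
  rw [mem_relCell_iff]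
  intro r hr
  have a := hq r hr
  have b := hx.1 r hr
  have c := tight_subset_iff.1 hx.2 r hr
  rw [term_lineMap, term_lineMap]
  refine ⟨by nlinarith, fun h => ?_, fun h => by rw [h, c h]⟩
  refine le_antisymm a ?_
  have : (1 - t) * term p r.1 x ≤ (1 - t) * term p r.2 x :=
    mul_le_mul_of_nonneg_left b (by linarith)
  exact le_of_mul_le_mul_left (by linarith) h0

lemma closure_relCell (hq : q ∈ relPoly p R) :
    closure (relCell p R (tight p R q)) = relFace p R (tight p R q) := by
  refine Set.Subset.antisymm
    (closure_minimal (relCell_subset_relFace _) isClosed_relFace_tight) fun x hx => ?_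
  have c : Continuous fun t : ℝ => AffineMap.lineMap x q t := AffineMap.lineMap_continuous
  have l : Filter.Tendsto (fun t : ℝ => AffineMap.lineMap x q t) (nhdsWithin 0 (Set.Ioi 0))
      (nhds x) := by
    have := c.tendsto 0
    rw [AffineMap.lineMap_apply_zero] at this
    exact this.mono_left nhdsWithin_le_nhds
  refine mem_closure_of_tendsto l ?_
  filter_upwards [Ioc_mem_nhdsGT (zero_lt_one (α := ℝ))] with t ht
  exact lineMap_mem_relCell hq hx ht.1 ht.2

/-- The affine subspace on which the equations in `t` hold. -/
def eqSubspace (p : (Fin d → ℤ) → ℝ) (t : Finset ((Fin d → ℤ) × (Fin d → ℤ))) :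
    AffineSubspace ℝ (Fin d → ℝ) where
  carrier := {x | ∀ r ∈ t, term p r.1 x = term p r.2 x}
  smul_vsub_vadd_mem' := by
    intro c x y z hx hy hz r hr
    have e : ∀ i, term p i (c • (x -ᵥ y) +ᵥ z) = c * (term p i x - term p i y) + term p i z := by
      intro i
      simp only [term, pair, vsub_eq_sub, vadd_eq_add, Pi.add_apply, Pi.smul_apply, Pi.sub_apply,
        smul_eq_mul, add_sub_add_left_eq_sub, ← Finset.sum_sub_distrib, Finset.mul_sum]
      rw [add_left_comm, ← Finset.sum_add_distrib]
      congr 1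
      exact Finset.sum_congr rfl fun k _ => by ring
    rw [e, e, hx r hr, hy r hr, hz r hr]

/-- From an interior point the segment starting at `q` can be prolonged inside the face; an
inequality tight there but strict at `q` would then be violated. Conversely, the equations tight at
`q` hold on the whole affine span, and the other inequalities are strict, an open condition. -/
lemma intrinsicInterior_relFace (hq : q ∈ relPoly p R) :
    intrinsicInterior ℝ (relFace p R (tight p R q)) = relCell p R (tight p R q) := by
  have hqF : q ∈ relFace p R (tight p R q) := ⟨hq, subset_rfl⟩
  ext x
  rw [mem_intrinsicInterior]
  constructor
  · rintro ⟨y, hy, rfl⟩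
    have hyF : (y : Fin d → ℝ) ∈ relFace p R (tight p R q) := (interior_subset hy :)
    let q' : affineSpan ℝ (relFace p R (tight p R q)) := ⟨q, subset_affineSpan ℝ _ hqF⟩
    have : Nonempty (affineSpan ℝ (relFace p R (tight p R q))) := ⟨q'⟩
    have c : Continuous fun t : ℝ => AffineMap.lineMap (q : Fin d → ℝ) y.1 (1 + t) :=
      AffineMap.lineMap_continuous.comp (continuous_const.add continuous_id)
    let g : ℝ → affineSpan ℝ (relFace p R (tight p R q)) := fun t =>
      ⟨AffineMap.lineMap (q : Fin d → ℝ) y.1 (1 + t), AffineMap.lineMap_mem _ q'.2 y.2⟩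
    have cg : Continuous g := c.subtype_mk _
    have g0 : g 0 = y := Subtype.ext (by simp [g])
    have ev : ∀ᶠ t in nhdsWithin (0 : ℝ) (Set.Ioi 0),
        AffineMap.lineMap (q : Fin d → ℝ) y.1 (1 + t) ∈ relPoly p R := by
      apply Filter.Eventually.filter_mono nhdsWithin_le_nhds
      have := cg.continuousAt (x := (0 : ℝ)) |>.preimage_mem_nhds
        (by rw [g0]; exact mem_interior_iff_mem_nhds.1 hy)
      exact Filter.Eventually.mono this fun t ht => ht.1
    obtain ⟨ε, h1, h2⟩ := (ev.and self_mem_nhdsWithin).exists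
    have h2 : 0 < ε := h2
    rw [mem_relCell_iff]
    intro r hr
    refine ⟨hyF.1 r hr, fun h => ?_, tight_subset_iff.1 hyF.2 r hr⟩
    have a := h1 r hr
    rw [term_lineMap, term_lineMap, h] at a
    refine le_antisymm (hq r hr) (le_of_mul_le_mul_left ?_ h2)
    linarith
  · intro hx
    have hxF := relCell_subset_relFace _ hx
    refine ⟨⟨x, subset_affineSpan ℝ _ hxF⟩, ?_, rfl⟩
    rw [mem_interior_iff_mem_nhds]
    have hle : affineSpan ℝ (relFace p R (tight p R q)) ≤ eqSubspace p (tight p R q) :=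
      affineSpan_le.2 fun z hz r hr => (mem_tight.1 (hz.2 hr)).2
    have ev : ∀ᶠ z : affineSpan ℝ (relFace p R (tight p R q)) in
        nhds ⟨x, subset_affineSpan ℝ _ hxF⟩, ∀ r ∈ R, term p r.1 z.1 ≤ term p r.2 z.1 := by
      rw [Filter.eventually_all_finset]
      intro r hr
      by_cases e : term p r.1 q = term p r.2 q
      · exact Filter.Eventually.of_forall fun z => (hle z.2 r (mem_tight.2 ⟨hr, e⟩)).le
      · have h := (mem_relCell_iff).1 hx r hr
        have hlt := lt_of_le_of_ne h.1 fun e' => e (h.2.1 e')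
        have := ((continuous_term p r.1).comp continuous_subtype_val).continuousAt.eventually_lt
          ((continuous_term p r.2).comp continuous_subtype_val).continuousAt
          (x₀ := (⟨x, subset_affineSpan ℝ _ hxF⟩ : affineSpan ℝ (relFace p R (tight p R q)))) hlt
        exact this.mono fun _ h => h.le
    exact ev.mono fun z hz => ⟨hz, fun r hr => mem_tight.2 ⟨tight_subset hr, hle z.2 r hr⟩⟩

/-! ### Exposed faces -/

/-- The linear form `⟨i, ·⟩`. -/
def pairLin (i : Fin d → ℤ) : (Fin d → ℝ) →ₗ[ℝ] ℝ := ∑ k, (i k : ℝ) • LinearMap.proj k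

lemma pairLin_apply (i : Fin d → ℤ) (x : Fin d → ℝ) : pairLin i x = pair i x := by
  simp [pairLin, pair]

/-- The exposing functional is the sum of the tight forms. Up to constants, its summands are
nonpositive on the polyhedron and vanish at `q`, so it is maximal exactly where all of them vanish.
-/
lemma isExposed_relFace (hq : q ∈ relPoly p R) :
    IsExposed ℝ (relPoly p R) (relFace p R (tight p R q)) := by
  intro _
  refine ⟨LinearMap.toContinuousLinearMap (∑ r ∈ tight p R q, (pairLin r.1 - pairLin r.2)), ?_⟩
  have e : ∀ x, LinearMap.toContinuousLinearMap
      (∑ r ∈ tight p R q, (pairLin r.1 - pairLin r.2)) x =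
      ∑ r ∈ tight p R q, (term p r.1 x - term p r.2 x) - ∑ r ∈ tight p R q, (p r.1 - p r.2) := by
    intro x
    simp only [LinearMap.coe_toContinuousLinearMap', LinearMap.sum_apply, LinearMap.sub_apply,
      pairLin_apply, ← Finset.sum_sub_distrib, term]
    exact Finset.sum_congr rfl fun r _ => by ring
  ext x
  simp only [Set.mem_ofPred_eq, e, sub_le_sub_iff_right]
  have zero : ∀ x, tight p R q ⊆ tight p R x →
      ∑ r ∈ tight p R q, (term p r.1 x - term p r.2 x) = 0 := fun x hx =>
    Finset.sum_eq_zero fun r hr => by rw [(mem_tight.1 (hx hr)).2, sub_self]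
  have nonpos : ∀ x ∈ relPoly p R, ∀ r ∈ tight p R q, term p r.1 x - term p r.2 x ≤ 0 :=
    fun x hx r hr => sub_nonpos.2 (hx r (tight_subset hr))
  constructor
  · rintro ⟨hx, h⟩
    exact ⟨hx, fun y hy => (Finset.sum_nonpos (nonpos y hy)).trans (zero x h).ge⟩
  · rintro ⟨hx, h⟩
    refine ⟨hx, fun r hr => mem_tight.2 ⟨tight_subset hr, ?_⟩⟩
    have h0 := h q hq
    rw [zero q subset_rfl] at h0
    have := (Finset.sum_eq_zero_iff_of_nonpos (nonpos x hx)).1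
      (le_antisymm (Finset.sum_nonpos (nonpos x hx)) h0) r hr
    linarith

/-- In a nonempty convex subset of a polyhedron, some point has the least set of tight
inequalities. -/
lemma exists_least_tight {G : Set (Fin d → ℝ)} (hG : G.Nonempty) (hc : Convex ℝ G)
    (hsub : G ⊆ relPoly p R) : ∃ q ∈ G, ∀ x ∈ G, tight p R q ⊆ tight p R x := by
  obtain ⟨q, hq, hmin⟩ := exists_minimalFor_of_wellFoundedLT (· ∈ G)
    (fun x => (tight p R x).card) hG
  refine ⟨q, hq, fun x hx => ?_⟩
  have hm : AffineMap.lineMap x q (1 / 2 : ℝ) ∈ G :=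
    hc.lineMap_mem hx hq ⟨by norm_num, by norm_num⟩
  -- Only inequalities tight at both ends are tight at the midpoint; minimal cardinality at `q` then
  -- forces those of `q` to be tight at `x`.
  have hboth : ∀ r ∈ tight p R (AffineMap.lineMap x q (1 / 2 : ℝ)),
      r ∈ tight p R q ∧ r ∈ tight p R x := by
    intro r hr
    obtain ⟨hr, e⟩ := mem_tight.1 hr
    rw [term_lineMap, term_lineMap] at e
    have a := hsub hx r hr
    have b := hsub hq r hr
    exact ⟨mem_tight.2 ⟨hr, by linarith⟩, mem_tight.2 ⟨hr, by linarith⟩⟩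
  have hle : tight p R (AffineMap.lineMap x q (1 / 2 : ℝ)) ⊆ tight p R q :=
    fun r hr => (hboth r hr).1
  have heq := Finset.eq_of_subset_of_card_le hle (hmin hm (Finset.card_le_card hle))
  exact fun r hr => (hboth r (heq ▸ hr)).2

lemma convex_relPoly : Convex ℝ (relPoly p R) := by
  rw [convex_iff_add_mem]
  intro x hx y hy a b ha hb hab r hr
  have e : a • x + b • y = AffineMap.lineMap x y b := by
    rw [AffineMap.lineMap_apply_module, ← hab, add_sub_cancel_right]
  rw [e, term_lineMap, term_lineMap]
  have h1 := mul_le_mul_of_nonneg_left (hx r hr) ha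
  have h2 := mul_le_mul_of_nonneg_left (hy r hr) hb
  rw [← hab, add_sub_cancel_right]
  linarith

lemma exists_eq_relFace_of_isExposed {G : Set (Fin d → ℝ)} (hG : G.Nonempty)
    (h : IsExposed ℝ (relPoly p R) G) :
    ∃ q ∈ relPoly p R, G = relFace p R (tight p R q) := by
  obtain ⟨q, hqG, hmin⟩ := exists_least_tight hG (h.convex convex_relPoly) h.subset
  obtain ⟨l, hl⟩ := h hG
  refine ⟨q, h.subset hqG, Set.Subset.antisymm (fun x hx => ⟨h.subset hx, hmin x hx⟩) ?_⟩
  rintro x ⟨hx, hqx⟩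
  -- `q` lies strictly between `x` and a point of the polyhedron, so a functional maximal at `q` is
  -- also maximal at `x`.
  obtain ⟨ε, hε, hmem⟩ := exists_extension (h.subset hqG) hqx
  rw [hl] at hqG ⊢
  refine ⟨hx, fun y hy => (hqG.2 y hy).trans ?_⟩
  have := hqG.2 _ hmem
  rw [AffineMap.lineMap_apply_module] at this
  simp only [map_add, map_smul, smul_eq_mul] at this
  exact le_of_mul_le_mul_left (by linarith) hε

end Polyhedra

/-! ### Flags -/

section Flags

variable {d : ℕ} {A S F : Finset (Fin d → ℤ)} {p : (Fin d → ℤ) → ℝ} {i j k : Fin d → ℤ}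
  {q q' : Fin d → ℝ}

lemma mem_minimizers : i ∈ minimizers S p q ↔ i ∈ S ∧ ∀ j ∈ S, term p i q ≤ term p j q := by
  simp [minimizers]

lemma minimizers_subset : minimizers S p q ⊆ S := Finset.filter_subset _ _

lemma mem_outside : i ∈ outside A F ↔ i ∈ A ∧ toReal i ∉ span F := by
  simp [outside]

lemma exists_mem_minimizers (hS : S.Nonempty) : ∃ i, i ∈ minimizers S p q := by
  obtain ⟨i, hi, h⟩ := S.exists_min_image (fun i => term p i q) hS
  exact ⟨i, mem_minimizers.2 ⟨hi, h⟩⟩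

/-- A member of `S` at which the value is that of a minimizer is a minimizer. -/
lemma mem_minimizers_iff_of_mem (hi : i ∈ minimizers S p q) (hj : j ∈ S) :
    j ∈ minimizers S p q ↔ term p i q = term p j q := by
  rw [mem_minimizers] at *
  refine ⟨fun h => le_antisymm (hi.2 j hj) (h.2 i hi.1), fun h => ⟨hj, fun k hk => ?_⟩⟩
  rw [← h]; exact hi.2 k hk

lemma toReal_mem_span (hi : i ∈ S) : toReal i ∈ span S :=
  subset_affineSpan ℝ _ ⟨i, hi, rfl⟩

lemma span_le_span_iff : span S ≤ span F ↔ ∀ i ∈ S, toReal i ∈ span F := by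
  rw [span, affineSpan_le]
  constructor
  · exact fun h i hi => h ⟨i, hi, rfl⟩
  · rintro h _ ⟨i, hi, rfl⟩; exact h i hi

lemma span_mono (h : S ⊆ F) : span S ≤ span F :=
  span_le_span_iff.2 fun _ hi => toReal_mem_span (h hi)

lemma toReal_not_mem_span_empty : toReal i ∉ span (∅ : Finset (Fin d → ℤ)) := by
  rw [span, Finset.coe_empty, Set.image_empty, AffineSubspace.span_empty]
  exact AffineSubspace.notMem_bot _ _ _

lemma outside_empty : outside A ∅ = A :=
  Finset.filter_true_of_mem fun _ _ => toReal_not_mem_span_empty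

lemma affDim_le (S : Finset (Fin d → ℤ)) : affDim S ≤ d := by
  simpa [affDim] using Submodule.finrank_le (span S).direction

lemma affDim_mono (h : span S ≤ span F) : affDim S ≤ affDim F :=
  Submodule.finrank_mono (AffineSubspace.direction_le h)

lemma span_nonempty (hS : S.Nonempty) : (span S : Set (Fin d → ℝ)).Nonempty := by
  obtain ⟨i, hi⟩ := hS
  exact ⟨_, toReal_mem_span hi⟩

/-- Nonemptiness matters: `affDim ∅ = 0`, which is `d` when `d = 0`. -/
lemma span_eq_top (hS : S.Nonempty) (h : affDim S = d) : span S = ⊤ := by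
  rw [← AffineSubspace.direction_eq_top_iff_of_nonempty (span_nonempty hS)]
  exact Submodule.eq_top_of_finrank_eq (by simpa [affDim] using h)

lemma affDim_lt (hS : S.Nonempty) (h : span S < span F) : affDim S < affDim F := by
  refine lt_of_le_of_ne (affDim_mono h.le) fun e => h.ne ?_
  exact AffineSubspace.eq_of_direction_eq_of_nonempty_of_le
    (Submodule.eq_of_le_of_finrank_eq (AffineSubspace.direction_le h.le) e) (span_nonempty hS) h.le

/-- The flag, preceded by the empty set. -/
def chain (A : Finset (Fin d → ℤ)) (p : (Fin d → ℤ) → ℝ) (q : Fin d → ℝ) :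
    ℕ → Finset (Fin d → ℤ)
  | 0 => ∅
  | n + 1 => nextStep A p q (chain A p q n)

/-- The span of `∅` is empty, so `F_0` arises by the same step as its successors. The shift by one
lets inductions start at a trivial case. -/
lemma flag_eq_chain (n : ℕ) : flag A p q n = chain A p q (n + 1) := by
  induction n with
  | zero => simp [flag, chain, nextStep, outside_empty]
  | succ n ih => rw [flag, ih, ← chain]

lemma flag_eq_iff_chain_eq : flag A p q' = flag A p q ↔ chain A p q' = chain A p q := by
  constructor
  · intro h
    funext n
    cases n with
    | zero => rfl
    | succ n => rw [← flag_eq_chain, ← flag_eq_chain, h]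
  · intro h
    funext n
    rw [flag_eq_chain, flag_eq_chain, h]

lemma mem_chain_succ {n : ℕ} : i ∈ chain A p q (n + 1) ↔
    i ∈ chain A p q n ∨ i ∈ minimizers (outside A (chain A p q n)) p q := by
  rw [chain, nextStep, Finset.mem_union]

lemma chain_mono : Monotone (chain A p q) :=
  monotone_nat_of_le_succ fun _ _ hi => mem_chain_succ.2 (Or.inl hi)

lemma chain_subset (n : ℕ) : chain A p q n ⊆ A := by
  induction n with
  | zero => simp [chain]
  | succ n ih =>
    intro i hi
    rcases mem_chain_succ.1 hi with h | h
    · exact ih h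
    · exact (mem_outside.1 (minimizers_subset h)).1

lemma minimizers_outside_chain (n : ℕ) :
    minimizers (outside A (chain A p q n)) p q = chain A p q (n + 1) \ chain A p q n := by
  ext i
  rw [Finset.mem_sdiff, mem_chain_succ]
  constructor
  · exact fun h => ⟨Or.inr h, fun h' =>
      (mem_outside.1 (minimizers_subset h)).2 (toReal_mem_span h')⟩
  · rintro ⟨h | h, h'⟩
    · exact absurd h h'
    · exact h

/-- The values on a member of the flag are less than those outside of its affine span. -/
lemma term_lt_term_of_mem_chain {n : ℕ} (hi : i ∈ chain A p q n) (hj : j ∈ A)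
    (hj' : toReal j ∉ span (chain A p q n)) : term p i q < term p j q := by
  induction n with
  | zero => simp [chain] at hi
  | succ n ih =>
    have hjn : toReal j ∉ span (chain A p q n) := fun h =>
      hj' (span_mono (chain_mono n.le_succ) h)
    rcases mem_chain_succ.1 hi with h | h
    · exact ih h hjn
    · have hjo : j ∈ outside A (chain A p q n) := mem_outside.2 ⟨hj, hjn⟩
      refine lt_of_le_of_ne ((mem_minimizers.1 h).2 j hjo) fun e => hj' (toReal_mem_span ?_)
      exact mem_chain_succ.2 (Or.inr ((mem_minimizers_iff_of_mem h hjo).2 e))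

lemma outside_nonempty (hA : affDim A = d) (hF : affDim F < d) : (outside A F).Nonempty := by
  by_contra h
  rw [Finset.not_nonempty_iff_eq_empty] at h
  have hle : span A ≤ span F := span_le_span_iff.2 fun i hi => by
    by_contra hn
    exact Finset.notMem_empty i (h ▸ mem_outside.2 ⟨hi, hn⟩)
  have := affDim_mono hle
  omega

lemma span_lt_span_nextStep (hA : affDim A = d) (hF : affDim F < d) :
    span F < span (nextStep A p q F) := by
  obtain ⟨i, hi⟩ := exists_mem_minimizers (p := p) (q := q) (outside_nonempty hA hF)
  refine lt_of_le_of_ne (span_mono Finset.subset_union_left) fun e => ?_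
  refine (mem_outside.1 (minimizers_subset hi)).2 ?_
  rw [e]
  exact toReal_mem_span (Finset.mem_union_right _ hi)

lemma nextStep_eq_self (hF : span F = ⊤) : nextStep A p q F = F := by
  have : outside A F = ∅ := Finset.filter_false_of_mem fun i _ => by
    rw [hF, not_not]; exact AffineSubspace.mem_top _ _ _
  rw [nextStep, this]
  simp [minimizers]

lemma nonempty_of_mem_tropHypersurface (hq : q ∈ tropHypersurface A p) :
    (minimizers A p q).Nonempty := by
  obtain ⟨i, hi, -⟩ := hq
  exact ⟨i, hi⟩

lemma flag_nonempty (hq : q ∈ tropHypersurface A p) (n : ℕ) : (flag A p q n).Nonempty := by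
  obtain ⟨i, hi⟩ := nonempty_of_mem_tropHypersurface hq
  rw [flag_eq_chain]
  refine ⟨i, chain_mono (Nat.le_add_left 1 n) ?_⟩
  rw [← zero_add 1, ← flag_eq_chain]
  exact hi

lemma flag_eq_of_affDim_eq (hq : q ∈ tropHypersurface A p) {r n : ℕ}
    (hr : affDim (flag A p q r) = d) (hn : r ≤ n) : flag A p q n = flag A p q r := by
  induction n, hn using Nat.le_induction with
  | base => rfl
  | succ n _ ih => rw [flag, ih, nextStep_eq_self (span_eq_top (flag_nonempty hq r) hr)]

lemma exists_flag_length (hA : affDim A = d) (hq : q ∈ tropHypersurface A p) :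
    ∃ r, (∀ n < r, affDim (flag A p q n) < d) ∧ affDim (flag A p q r) = d := by
  have h : ∃ r, affDim (flag A p q r) = d := by
    by_contra hcon
    push Not at hcon
    have hlt : ∀ n, affDim (flag A p q n) < d := fun n => lt_of_le_of_ne (affDim_le _) (hcon n)
    -- The dimension grows at each step, which is impossible for `n = d`.
    have hge : ∀ n, n ≤ affDim (flag A p q n) := by
      intro n
      induction n with
      | zero => exact Nat.zero_le _
      | succ n ih =>
        have := affDim_lt (flag_nonempty hq n) (span_lt_span_nextStep (p := p) (q := q) hA (hlt n))
        rw [flag]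
        omega
    exact absurd (hge d) (not_le.2 (hlt d))
  refine ⟨Nat.find h, fun n hn => ?_, Nat.find_spec h⟩
  exact lt_of_le_of_ne (affDim_le _) (Nat.find_min h hn)

lemma flag_ssubset_of_affDim_lt (hA : affDim A = d) {n : ℕ} (hn : affDim (flag A p q n) < d) :
    flag A p q n ⊂ flag A p q (n + 1) := by
  refine Finset.ssubset_iff_subset_ne.2 ⟨Finset.subset_union_left, fun e => ?_⟩
  have := span_lt_span_nextStep (p := p) (q := q) hA hn
  rw [← flag, ← e] at this
  exact this.ne rfl

/-- The first member of the flag whose affine span contains a given exponent. -/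
lemma exists_chain_index (hA : affDim A = d) (hq : q ∈ tropHypersurface A p)
    (i : Fin d → ℤ) : ∃ n, toReal i ∉ span (chain A p q n) ∧
      toReal i ∈ span (chain A p q (n + 1)) := by
  have h : ∃ n, toReal i ∈ span (chain A p q n) := by
    obtain ⟨r, -, hr⟩ := exists_flag_length hA hq
    refine ⟨r + 1, ?_⟩
    rw [← flag_eq_chain, span_eq_top (flag_nonempty hq r) hr]
    exact AffineSubspace.mem_top _ _ _
  have h0 : Nat.find h ≠ 0 := fun h0 => by
    have := Nat.find_spec h
    rw [h0] at this
    exact toReal_not_mem_span_empty this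
  obtain ⟨n, hn⟩ := Nat.exists_eq_succ_of_ne_zero h0
  exact ⟨n, Nat.find_min h (by omega), by have := Nat.find_spec h; rwa [hn] at this⟩

/-! ### The inequalities that define a weight class -/

/-- The exponents at which the value at `q` is less than that at `i`. -/
def below (A : Finset (Fin d → ℤ)) (p : (Fin d → ℤ) → ℝ) (q : Fin d → ℝ) (i : Fin d → ℤ) :
    Finset (Fin d → ℤ) :=
  A.filter fun k => term p k q < term p i q

lemma mem_below : k ∈ below A p q i ↔ k ∈ A ∧ term p k q < term p i q := by
  simp [below]

/-- The pairs `(i, j)` such that neither `i` nor `j` is in the affine span of the exponents with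
value at `q` less than that at `i`. -/
def flagRel (A : Finset (Fin d → ℤ)) (p : (Fin d → ℤ) → ℝ) (q : Fin d → ℝ) :
    Finset ((Fin d → ℤ) × (Fin d → ℤ)) :=
  (A ×ˢ A).filter fun r => toReal r.1 ∉ span (below A p q r.1) ∧
    toReal r.2 ∉ span (below A p q r.1)

lemma mem_flagRel : (i, j) ∈ flagRel A p q ↔
    (i ∈ A ∧ j ∈ A) ∧ toReal i ∉ span (below A p q i) ∧ toReal j ∉ span (below A p q i) := by
  simp [flagRel]

lemma below_eq_of_term_eq (h : term p i q = term p j q) : below A p q i = below A p q j := by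
  rw [below, below, h]

lemma swap_mem_flagRel (h : (i, j) ∈ flagRel A p q) (e : term p i q = term p j q) :
    (j, i) ∈ flagRel A p q := by
  rw [mem_flagRel, ← below_eq_of_term_eq e]
  have := mem_flagRel.1 h
  exact ⟨this.1.symm, this.2.symm⟩

lemma mem_relPoly_flagRel (q : Fin d → ℝ) : q ∈ relPoly p (flagRel A p q) := by
  rintro ⟨i, j⟩ h
  obtain ⟨⟨-, hj⟩, -, h⟩ := mem_flagRel.1 h
  by_contra hn
  exact h (toReal_mem_span (mem_below.2 ⟨hj, not_le.1 hn⟩))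

/-- A pair tight at `q` occurs with its reverse, so equality holds on the whole polyhedron. -/
lemma relFace_flagRel_self :
    relFace p (flagRel A p q) (tight p (flagRel A p q) q) = relPoly p (flagRel A p q) := by
  refine Set.Subset.antisymm (fun x hx => hx.1) fun x hx => ⟨hx, tight_subset_iff.2 ?_⟩
  rintro ⟨i, j⟩ hr e
  exact le_antisymm (hx _ hr) (hx _ (swap_mem_flagRel hr e))

/-- The faces of the polyhedron of the flag at `q` are the polyhedra of the flags at its points. -/
lemma relPoly_flagRel_eq_relFace (hq' : q' ∈ relPoly p (flagRel A p q)) :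
    relPoly p (flagRel A p q') = relFace p (flagRel A p q) (tight p (flagRel A p q) q') := by
  -- Inside the polyhedron of `q`, an exponent outside the span of those below `i` stays at or above
  -- `i`. The spans to be avoided only shrink and the relation only grows.
  have hsub : flagRel A p q ⊆ flagRel A p q' := by
    rintro ⟨i, j⟩ h
    rw [mem_flagRel] at h ⊢
    have hle : span (below A p q' i) ≤ span (below A p q i) := span_le_span_iff.2 fun k hk => by
      by_contra hn
      have := hq' (i, k) (mem_flagRel.2 ⟨⟨h.1.1, (mem_below.1 hk).1⟩, h.2.1, hn⟩)
      exact absurd (mem_below.1 hk).2 (not_lt.2 this)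
    exact ⟨h.1, fun h' => h.2.1 (hle h'), fun h' => h.2.2 (hle h')⟩
  apply Set.Subset.antisymm
  · refine fun x hx => ⟨fun r hr => hx r (hsub hr), tight_subset_iff.2 ?_⟩
    rintro ⟨i, j⟩ hr e
    exact le_antisymm (hx _ (hsub hr)) (hx _ (swap_mem_flagRel (hsub hr) e))
  · rintro x ⟨hx, ht⟩ ⟨i, j⟩ hr
    obtain ⟨⟨hi, hj⟩, h1, h2⟩ := mem_flagRel.1 hr
    -- The minimum is taken with the values at `q`, so that both `(m, i)` and `(m, j)` are pairs of
    -- `q`. At `q'` the first is tight, so at `x` the value at `i` equals that at `m`, which is at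
    -- most that at `j`.
    obtain ⟨m, hm, hmin⟩ := (outside A (below A p q' i)).exists_min_image (fun k => term p k q)
      ⟨i, mem_outside.2 ⟨hi, h1⟩⟩
    obtain ⟨hmA, hm⟩ := mem_outside.1 hm
    have hle : span (below A p q m) ≤ span (below A p q' i) := span_le_span_iff.2 fun k hk => by
      by_contra hn
      exact absurd (mem_below.1 hk).2
        (not_lt.2 (hmin k (mem_outside.2 ⟨(mem_below.1 hk).1, hn⟩)))
    have hmi : (m, i) ∈ flagRel A p q :=
      mem_flagRel.2 ⟨⟨hmA, hi⟩, fun h => hm (hle h), fun h => h1 (hle h)⟩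
    have hmj : (m, j) ∈ flagRel A p q :=
      mem_flagRel.2 ⟨⟨hmA, hj⟩, fun h => hm (hle h), fun h => h2 (hle h)⟩
    have e : term p m q' = term p i q' := by
      refine le_antisymm (hq' _ hmi) ?_
      by_contra hn
      exact hm (toReal_mem_span (mem_below.2 ⟨hmA, not_le.1 hn⟩))
    have := tight_subset_iff.1 ht _ hmi e
    exact this.ge.trans (hx _ hmj)

lemma below_subset_of_mem_outside {n : ℕ} (hi : i ∈ minimizers (outside A (chain A p q n)) p q) :
    span (below A p q i) ≤ span (chain A p q n) := by
  refine span_le_span_iff.2 fun k hk => ?_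
  by_contra hn
  obtain ⟨hk, hlt⟩ := mem_below.1 hk
  exact absurd hlt (not_lt.2 ((mem_minimizers.1 hi).2 k (mem_outside.2 ⟨hk, hn⟩)))

/-- A pair of the relation consists of a minimizer and a member of some `A - ⟨F_ℓ⟩`. -/
lemma exists_index_of_mem_flagRel (hA : affDim A = d) (hq : q ∈ tropHypersurface A p)
    (h : (i, j) ∈ flagRel A p q) : ∃ n, i ∈ minimizers (outside A (chain A p q n)) p q ∧
      j ∈ outside A (chain A p q n) := by
  obtain ⟨⟨hi, hj⟩, h1, h2⟩ := mem_flagRel.1 h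
  obtain ⟨n, hn, hn'⟩ := exists_chain_index hA hq i
  have hle : ∀ k ∈ chain A p q n, k ∈ below A p q i := fun k hk =>
    mem_below.2 ⟨chain_subset n hk, term_lt_term_of_mem_chain hk hi hn⟩
  have hjo : j ∈ outside A (chain A p q n) := mem_outside.2 ⟨hj, fun h => h2 (span_mono hle h)⟩
  have hio : i ∈ outside A (chain A p q n) := mem_outside.2 ⟨hi, hn⟩
  refine ⟨n, ?_, hjo⟩
  -- If `i` were not a minimizer, the whole next member, whose span contains `i`, would lie below
  -- `i`.
  by_contra hnot
  refine h1 (span_mono (fun k hk => ?_) hn')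
  rcases mem_chain_succ.1 hk with hk | hk
  · exact hle k hk
  · refine mem_below.2 ⟨(mem_outside.1 (minimizers_subset hk)).1,
      lt_of_le_of_ne ((mem_minimizers.1 hk).2 i hio) fun e => hnot ?_⟩
    exact (mem_minimizers_iff_of_mem hk hio).2 e

lemma minimizers_congr
    (h : ∀ i ∈ minimizers S p q, ∀ j ∈ S, term p i q' ≤ term p j q' ∧
      (term p i q' = term p j q' ↔ term p i q = term p j q)) :
    minimizers S p q' = minimizers S p q := by
  rcases S.eq_empty_or_nonempty with rfl | hS
  · simp [minimizers]
  obtain ⟨i, hi⟩ := exists_mem_minimizers (p := p) (q := q) hS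
  have hi' : i ∈ minimizers S p q' :=
    mem_minimizers.2 ⟨minimizers_subset hi, fun j hj => (h i hi j hj).1⟩
  ext j
  by_cases hj : j ∈ S
  · rw [mem_minimizers_iff_of_mem hi hj, mem_minimizers_iff_of_mem hi' hj, (h i hi j hj).2]
  · exact ⟨fun h => absurd (minimizers_subset h) hj, fun h => absurd (minimizers_subset h) hj⟩

/-- Each pair of the relation compares a minimizer of one step with a competitor of that step, and
the flag records the minimizers. Conversely, these comparisons reproduce the flag step by step. -/
lemma weightClass_eq_relCell (hA : affDim A = d) (hq : q ∈ tropHypersurface A p) :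
    weightClass A p q = relCell p (flagRel A p q) (tight p (flagRel A p q) q) := by
  ext x
  rw [mem_relCell_iff]
  constructor
  · rintro ⟨-, hx⟩ ⟨i, j⟩ hr
    rw [flag_eq_iff_chain_eq] at hx
    obtain ⟨n, hi, hj⟩ := exists_index_of_mem_flagRel hA hq hr
    have e : minimizers (outside A (chain A p q n)) p x =
        minimizers (outside A (chain A p q n)) p q := by
      rw [minimizers_outside_chain, ← hx, minimizers_outside_chain]
    have hi' := hi
    rw [← e] at hi'
    refine ⟨(mem_minimizers.1 hi').2 j hj, ?_⟩
    rw [← mem_minimizers_iff_of_mem hi hj, ← mem_minimizers_iff_of_mem hi' hj, e]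
  · intro h
    have hchain : ∀ n, chain A p x n = chain A p q n := by
      intro n
      induction n with
      | zero => rfl
      | succ n ih =>
        rw [chain, chain, ih, nextStep, nextStep]
        congr 1
        refine minimizers_congr fun i hi j hj => h (i, j) ?_
        have hle := below_subset_of_mem_outside hi
        rw [mem_outside] at hj
        have hi' := mem_outside.1 (minimizers_subset hi)
        exact mem_flagRel.2 ⟨⟨hi'.1, hj.1⟩, fun h => hi'.2 (hle h), fun h => hj.2 (hle h)⟩
    have hflag : flag A p x = flag A p q := flag_eq_iff_chain_eq.2 (funext hchain)
    refine ⟨?_, hflag⟩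
    have e : minimizers A p x = minimizers A p q := congrFun hflag 0
    rw [tropHypersurface, Set.mem_ofPred_eq, e]
    exact hq

lemma closure_weightClass (hA : affDim A = d) (hq : q ∈ tropHypersurface A p) :
    closure (weightClass A p q) = relPoly p (flagRel A p q) := by
  rw [weightClass_eq_relCell hA hq, closure_relCell (mem_relPoly_flagRel q), relFace_flagRel_self]

lemma intrinsicInterior_closure_weightClass (hA : affDim A = d)
    (hq : q ∈ tropHypersurface A p) :
    intrinsicInterior ℝ (closure (weightClass A p q)) = weightClass A p q := by
  rw [weightClass_eq_relCell hA hq, closure_relCell (mem_relPoly_flagRel q),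
    intrinsicInterior_relFace (mem_relPoly_flagRel q)]

lemma finite_weightClasses (hA : affDim A = d) : (weightClasses A p).Finite := by
  refine ((((A ×ˢ A).powerset ×ˢ (A ×ˢ A).powerset).finite_toSet).image
    fun s => relCell p s.1 s.2).subset ?_
  rintro _ ⟨q, hq, rfl⟩
  have h : flagRel A p q ⊆ A ×ˢ A := Finset.filter_subset _ _
  refine ⟨(flagRel A p q, tight p (flagRel A p q) q), ?_, (weightClass_eq_relCell hA hq).symm⟩
  simp only [Finset.coe_product, Set.mem_prod, Finset.mem_coe, Finset.mem_powerset]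
  exact ⟨h, tight_subset.trans h⟩

lemma mem_weightClass_self (hq : q ∈ tropHypersurface A p) : q ∈ weightClass A p q := ⟨hq, rfl⟩

/-! ### The dual cells -/

/-- With this relation, the results on closures and relative interiors apply to dual cells as well.
-/
lemma setOf_minimizers_eq : {x | minimizers A p x = minimizers A p q} =
    relCell p (minimizers A p q ×ˢ A) (tight p (minimizers A p q ×ˢ A) q) := by
  ext x
  rw [mem_relCell_iff]
  constructor
  · rintro hx ⟨i, j⟩ hr
    have hx : minimizers A p x = minimizers A p q := hx
    obtain ⟨hi, hj⟩ := Finset.mem_product.1 hr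
    have hi' : i ∈ minimizers A p x := hx ▸ hi
    refine ⟨(mem_minimizers.1 hi').2 j hj, ?_⟩
    rw [← mem_minimizers_iff_of_mem hi hj, ← mem_minimizers_iff_of_mem hi' hj, hx]
  · exact fun h => minimizers_congr fun i hi j hj => h (i, j) (Finset.mem_product.2 ⟨hi, hj⟩)

lemma mem_relPoly_minimizers (q : Fin d → ℝ) : q ∈ relPoly p (minimizers A p q ×ˢ A) := by
  rintro ⟨i, j⟩ hr
  obtain ⟨hi, hj⟩ := Finset.mem_product.1 hr
  exact (mem_minimizers.1 hi).2 j hj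

lemma dualCell_minimizers :
    dualCell A p (minimizers A p q) = relPoly p (minimizers A p q ×ˢ A) := by
  rw [dualCell, setOf_minimizers_eq, closure_relCell (mem_relPoly_minimizers q)]
  refine Set.Subset.antisymm (fun x hx => hx.1) fun x hx => ⟨hx, tight_subset_iff.2 ?_⟩
  rintro ⟨i, j⟩ hr e
  obtain ⟨hi, hj⟩ := Finset.mem_product.1 hr
  have hj' := (mem_minimizers_iff_of_mem hi hj).2 e
  exact le_antisymm (hx _ hr) (hx (j, i) (Finset.mem_product.2 ⟨hj', minimizers_subset hi⟩))

/-- This turns inclusions of dual cells into reversed inclusions of sets of minimizers, which is all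
the refinement needs. -/
lemma mem_dualCell_minimizers_iff {x : Fin d → ℝ} :
    x ∈ dualCell A p (minimizers A p q) ↔ minimizers A p q ⊆ minimizers A p x := by
  rw [dualCell_minimizers]
  constructor
  · exact fun h i hi => mem_minimizers.2 ⟨minimizers_subset hi,
      fun j hj => h (i, j) (Finset.mem_product.2 ⟨hi, hj⟩)⟩
  · rintro h ⟨i, j⟩ hr
    obtain ⟨hi, hj⟩ := Finset.mem_product.1 hr
    exact (mem_minimizers.1 (h hi)).2 j hj

lemma weightClass_subset_setOf_minimizers_eq :
    weightClass A p q ⊆ {x | minimizers A p x = minimizers A p q} :=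
  fun _ hx => congrFun hx.2 0

lemma weightClass_subset_intrinsicInterior :
    weightClass A p q ⊆ intrinsicInterior ℝ (dualCell A p (minimizers A p q)) := by
  refine weightClass_subset_setOf_minimizers_eq.trans ?_
  rw [dualCell, setOf_minimizers_eq, closure_relCell (mem_relPoly_minimizers q),
    intrinsicInterior_relFace (mem_relPoly_minimizers q)]

lemma exists_minimizers_eq_of_mem_markedSubdivision {σ : Finset (Fin d → ℤ)}
    (h : σ ∈ markedSubdivision A p) : ∃ q, minimizers A p q = σ := by
  obtain ⟨⟨m, hm⟩, u, β, hle, rfl⟩ := h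
  have neg : ∀ i, term p i (-u) = p i - pair i u := fun i => by
    simp [term, pair, sub_eq_add_neg]
  have hm' := Finset.mem_filter.1 hm
  -- The value of the i-th monomial at `-u` is p_i - ⟨i, u⟩, the height of the lifted point above
  -- the linear part, so touching means minimal.
  refine ⟨-u, ?_⟩
  ext i
  rw [mem_minimizers, Finset.mem_filter]
  refine and_congr_right fun hi => ⟨fun h => ?_, fun h j hj => ?_⟩
  · have h1 := h m hm'.1
    have h2 := hle i hi
    rw [neg, neg] at h1
    linarith [hm'.2]
  · rw [neg, neg]
    linarith [hle j hj]

lemma minimizers_mem_markedSubdivision (h : (minimizers A p q).Nonempty) :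
    minimizers A p q ∈ markedSubdivision A p := by
  refine ⟨h, ?_⟩
  obtain ⟨m, hm⟩ := h
  have neg : ∀ i, pair i (-q) = - pair i q := fun i => by simp [pair]
  have hm' := mem_minimizers.1 hm
  refine ⟨-q, term p m q, fun i hi => ?_, ?_⟩
  · have := hm'.2 i hi
    rw [neg]
    simp only [term] at *
    linarith
  · ext i
    rw [Finset.mem_filter]
    constructor
    · intro hi
      refine ⟨minimizers_subset hi, ?_⟩
      have := (mem_minimizers_iff_of_mem hm (minimizers_subset hi)).1 hi
      rw [neg, this, term]; ring
    · rintro ⟨hi, e⟩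
      rw [mem_minimizers_iff_of_mem hm hi]
      rw [neg] at e
      simp only [term] at *
      linarith

lemma two_le_card_minimizers_iff : 2 ≤ (minimizers A p q).card ↔ q ∈ tropHypersurface A p := by
  rw [← Nat.lt_iff_add_one_le, Finset.one_lt_card]
  exact Iff.rfl

lemma mem_hypersurfaceCells_iff {P : Set (Fin d → ℝ)} : P ∈ hypersurfaceCells A p ↔
    ∃ q ∈ tropHypersurface A p, P = dualCell A p (minimizers A p q) := by
  constructor
  · rintro ⟨σ, hσ, hc, rfl⟩
    obtain ⟨q, rfl⟩ := exists_minimizers_eq_of_mem_markedSubdivision hσ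
    exact ⟨q, two_le_card_minimizers_iff.1 hc, rfl⟩
  · rintro ⟨q, hq, rfl⟩
    exact ⟨_, minimizers_mem_markedSubdivision (nonempty_of_mem_tropHypersurface hq),
      two_le_card_minimizers_iff.2 hq, rfl⟩

lemma dualCell_subset_tropHypersurface (hq : q ∈ tropHypersurface A p) :
    dualCell A p (minimizers A p q) ⊆ tropHypersurface A p := by
  intro x hx
  rw [← two_le_card_minimizers_iff] at hq ⊢
  exact hq.trans (Finset.card_le_card (mem_dualCell_minimizers_iff.1 hx))

lemma closure_weightClass_subset_dualCell :
    closure (weightClass A p q) ⊆ dualCell A p (minimizers A p q) :=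
  closure_mono weightClass_subset_setOf_minimizers_eq

lemma sUnion_hypersurfaceCells : ⋃₀ hypersurfaceCells A p = tropHypersurface A p := by
  ext x
  constructor
  · rintro ⟨P, hP, hx⟩
    obtain ⟨q, hq, rfl⟩ := mem_hypersurfaceCells_iff.1 hP
    exact dualCell_subset_tropHypersurface hq hx
  · exact fun hx => ⟨_, mem_hypersurfaceCells_iff.2 ⟨x, hx, rfl⟩,
      mem_dualCell_minimizers_iff.2 subset_rfl⟩

lemma sUnion_closure_weightClasses :
    ⋃₀ (closure '' weightClasses A p) = tropHypersurface A p := by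
  ext x
  constructor
  · rintro ⟨_, ⟨_, ⟨q, hq, rfl⟩, rfl⟩, hx⟩
    exact dualCell_subset_tropHypersurface hq (closure_weightClass_subset_dualCell hx)
  · exact fun hx => ⟨_, ⟨_, ⟨x, hx, rfl⟩, rfl⟩, subset_closure (mem_weightClass_self hx)⟩

lemma refines_hypersurfaceCells :
    Refines (closure '' weightClasses A p) (hypersurfaceCells A p) := by
  constructor
  · rintro _ ⟨_, ⟨q, hq, rfl⟩, rfl⟩
    exact ⟨_, mem_hypersurfaceCells_iff.2 ⟨q, hq, rfl⟩, closure_weightClass_subset_dualCell⟩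
  · intro Q hQ
    obtain ⟨q, hq, rfl⟩ := mem_hypersurfaceCells_iff.1 hQ
    refine Set.Subset.antisymm (fun x hx => ?_) (Set.sUnion_subset fun P hP => hP.2)
    have hxT := dualCell_subset_tropHypersurface hq hx
    refine ⟨_, ⟨⟨_, ⟨x, hxT, rfl⟩, rfl⟩, ?_⟩, subset_closure (mem_weightClass_self hxT)⟩
    intro y hy
    exact mem_dualCell_minimizers_iff.2 ((mem_dualCell_minimizers_iff.1 hx).trans
      (mem_dualCell_minimizers_iff.1 (closure_weightClass_subset_dualCell hy)))

/-! ### The polyhedral complex of closed weight classes -/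

lemma relPoly_flagRel_mem (hA : affDim A = d) (hq : q ∈ tropHypersurface A p) :
    relPoly p (flagRel A p q) ∈ closure '' weightClasses A p :=
  ⟨_, ⟨q, hq, rfl⟩, closure_weightClass hA hq⟩

lemma mem_tropHypersurface_of_mem_relPoly (hA : affDim A = d) (hq : q ∈ tropHypersurface A p)
    (hq' : q' ∈ relPoly p (flagRel A p q)) : q' ∈ tropHypersurface A p := by
  rw [← closure_weightClass hA hq] at hq'
  exact dualCell_subset_tropHypersurface hq (closure_weightClass_subset_dualCell hq')

/-- At a point `x` of the intersection with least tight set, the polyhedron of the flag at `x` is a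
face of both polyhedra, and by minimality it contains the intersection. -/
lemma isExposed_inter_relPoly_flagRel (q q' : Fin d → ℝ) :
    IsExposed ℝ (relPoly p (flagRel A p q))
      (relPoly p (flagRel A p q) ∩ relPoly p (flagRel A p q')) := by
  intro hne
  obtain ⟨x, hx, hmin⟩ := exists_least_tight hne (convex_relPoly.inter convex_relPoly)
    Set.inter_subset_left
  have e := relPoly_flagRel_eq_relFace hx.1
  have e' := relPoly_flagRel_eq_relFace hx.2
  have h : relPoly p (flagRel A p q) ∩ relPoly p (flagRel A p q') =
      relFace p (flagRel A p q) (tight p (flagRel A p q) x) := by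
    refine Set.Subset.antisymm (fun y hy => ⟨hy.1, hmin y hy⟩) fun y hy => ⟨hy.1, ?_⟩
    rw [← e, e'] at hy
    exact hy.1
  rw [h]
  exact isExposed_relFace hx.1 ⟨x, hx.1, subset_rfl⟩

lemma isPolyhedralComplex_closure_weightClasses (hA : affDim A = d) :
    IsPolyhedralComplex (closure '' weightClasses A p) where
  finite := (finite_weightClasses hA).image _
  nonempty := by
    rintro _ ⟨_, ⟨q, hq, rfl⟩, rfl⟩
    exact ⟨q, subset_closure (mem_weightClass_self hq)⟩
  polyhedron := by
    rintro _ ⟨_, ⟨q, hq, rfl⟩, rfl⟩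
    rw [closure_weightClass hA hq]
    exact isRationalPolyhedron_relPoly
  face_mem := by
    rintro _ ⟨_, ⟨q, hq, rfl⟩, rfl⟩ G hG hE
    rw [closure_weightClass hA hq] at hE
    obtain ⟨x, hx, rfl⟩ := exists_eq_relFace_of_isExposed hG hE
    rw [← relPoly_flagRel_eq_relFace hx]
    exact relPoly_flagRel_mem hA (mem_tropHypersurface_of_mem_relPoly hA hq hx)
  inter_left := by
    rintro _ ⟨_, ⟨q, hq, rfl⟩, rfl⟩ _ ⟨_, ⟨q', hq', rfl⟩, rfl⟩
    rw [closure_weightClass hA hq, closure_weightClass hA hq']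
    exact isExposed_inter_relPoly_flagRel q q'
  inter_right := by
    rintro _ ⟨_, ⟨q, hq, rfl⟩, rfl⟩ _ ⟨_, ⟨q', hq', rfl⟩, rfl⟩
    rw [closure_weightClass hA hq, closure_weightClass hA hq', Set.inter_comm]
    exact isExposed_inter_relPoly_flagRel q' q

end Flags

/-! ### Integral affine functions and rational affine dependencies -/

section Rational

variable {d : ℕ} {S : Finset (Fin d → ℤ)} {i : Fin d → ℤ}

/-- The zero set of an integral affine function. -/
def IntAffine.zeroSet (L : IntAffine d) : AffineSubspace ℝ (Fin d → ℝ) where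
  carrier := {x | pair L.lin x + L.const = 0}
  smul_vsub_vadd_mem' := by
    intro c x y z hx hy hz
    have e : pair L.lin (c • (x -ᵥ y) +ᵥ z) =
        c * (pair L.lin x - pair L.lin y) + pair L.lin z := by
      simp only [← pairLin_apply, vsub_eq_sub, vadd_eq_add, map_add, map_smul, map_sub,
        smul_eq_mul]
    simp only [Set.mem_ofPred_eq] at hx hy hz ⊢
    rw [e]
    linear_combination c * hx - c * hy + hz

lemma IntAffine.toReal_mem_zeroSet (L : IntAffine d) : toReal i ∈ L.zeroSet ↔ L.eval i = 0 := by
  change pair L.lin (toReal i) + L.const = 0 ↔ _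
  rw [IntAffine.eval, ← Int.cast_inj (α := ℝ)]
  simp [pair, toReal]

lemma IntAffine.eval_eq_zero_of_mem_span (L : IntAffine d) (hS : ∀ s ∈ S, L.eval s = 0)
    (hi : toReal i ∈ span S) : L.eval i = 0 := by
  have hle : span S ≤ L.zeroSet := by
    rw [span, affineSpan_le]
    rintro _ ⟨s, hs, rfl⟩
    exact L.toReal_mem_zeroSet.2 (hS s hs)
  exact L.toReal_mem_zeroSet.1 (hle hi)

lemma toReal_mem_span_of_combination (c : (Fin d → ℤ) → ℚ) (h1 : ∑ s ∈ S, c s = 1)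
    (h : ∀ k, ∑ s ∈ S, c s * s k = i k) : toReal i ∈ span S := by
  have hw : ∑ s : S, (c s : ℝ) = 1 := by
    rw [Finset.sum_coe_sort S fun s => (c s : ℝ)]
    exact_mod_cast h1
  have hmem := affineCombination_mem_affineSpan hw (fun s : S => toReal (s : Fin d → ℤ))
  rw [Finset.affineCombination_eq_linear_combination _ _ _ hw] at hmem
  have hr : Set.range (fun s : S => toReal (s : Fin d → ℤ)) = toReal '' (S : Set (Fin d → ℤ)) := by
    ext x; simp
  rw [hr] at hmem
  suffices e : toReal i = ∑ s : S, (c s : ℝ) • toReal (s : Fin d → ℤ) by rw [e]; exact hmem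
  ext k
  rw [Finset.sum_apply]
  simp only [Pi.smul_apply, smul_eq_mul, toReal]
  rw [Finset.sum_coe_sort S fun s => (c s : ℝ) * (s k : ℝ)]
  exact_mod_cast (h k).symm

/-- A lattice point is a rational affine combination of `S`, or an integral affine function
separates it from `S`. -/
lemma exists_combination_or_intAffine (S : Finset (Fin d → ℤ)) (i : Fin d → ℤ) :
    (∃ c : (Fin d → ℤ) → ℚ, ∑ s ∈ S, c s = 1 ∧ ∀ k, ∑ s ∈ S, c s * s k = i k) ∨
      ∃ L : IntAffine d, (∀ s ∈ S, L.eval s = 0) ∧ L.eval i ≠ 0 := by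
  -- Homogenization turns affine combinations into linear ones, for which a functional over ℚ
  -- decides membership.
  let h : (Fin d → ℤ) → (Fin d → ℚ) × ℚ := fun s => (fun k => (s k : ℚ), 1)
  by_cases hi : h i ∈ Submodule.span ℚ (h '' (S : Set (Fin d → ℤ)))
  · left
    obtain ⟨c, hc⟩ := (Submodule.mem_span_image_finset_iff_exists_fun' ℚ).1 hi
    refine ⟨c, ?_, fun k => ?_⟩
    · simpa [h, Prod.snd_sum] using congrArg Prod.snd hc
    · simpa [h, Prod.fst_sum] using congrFun (congrArg Prod.fst hc) k
  · right
    obtain ⟨f, hf, hle⟩ := Submodule.exists_le_ker_of_notMem hi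
    let g : Option (Fin d) → ℚ := fun o =>
      o.elim (f (0, 1)) fun k => f (Pi.single k 1, 0)
    have hfg : ∀ s, f (h s) = ∑ k, g (some k) * s k + g none := by
      intro s
      have e : h s = ∑ k, (s k : ℚ) • ((Pi.single k 1, 0) : (Fin d → ℚ) × ℚ) + (0, 1) := by
        refine Prod.ext ?_ ?_
        · ext j
          simp [h, Prod.fst_sum, Finset.sum_apply, Pi.single_apply]
        · simp [h, Prod.snd_sum]
      rw [e, map_add, map_sum]
      simp only [map_smul, smul_eq_mul, g, Option.elim]
      congr 1
      exact Finset.sum_congr rfl fun k _ => mul_comm _ _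
    -- `b` is a common denominator of the linear coefficients and the constant term (`none`).
    obtain ⟨b, hb⟩ := IsLocalization.exist_integer_multiples_of_finite (nonZeroDivisors ℤ) g
    choose m hm using hb
    have hb0 : ((b : ℤ) : ℚ) ≠ 0 := Int.cast_ne_zero.2 (nonZeroDivisors.ne_zero b.2)
    let L : IntAffine d := ⟨fun k => m (some k), m none⟩
    have hL : ∀ s, (L.eval s : ℚ) = b * f (h s) := by
      intro s
      simp only [algebraMap_int_eq, eq_intCast, zsmul_eq_mul] at hm
      rw [hfg, IntAffine.eval]
      push_cast
      simp only [L, hm, mul_add, Finset.mul_sum]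
      congr 1
      exact Finset.sum_congr rfl fun k _ => by ring
    refine ⟨L, fun s hs => ?_, fun h0 => ?_⟩
    · have : f (h s) = 0 := hle (Submodule.subset_span ⟨s, hs, rfl⟩)
      have e := hL s
      rw [this, mul_zero] at e
      exact_mod_cast e
    · have e := hL i
      rw [h0, Int.cast_zero] at e
      exact mul_ne_zero hb0 hf e.symm

lemma exists_intAffine_of_not_mem_span (hi : toReal i ∉ span S) :
    ∃ L : IntAffine d, (∀ s ∈ S, L.eval s = 0) ∧ L.eval i ≠ 0 :=
  (exists_combination_or_intAffine S i).resolve_left fun ⟨c, h1, h⟩ =>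
    hi (toReal_mem_span_of_combination c h1 h)

/-- An integral affine function vanishing on `S` vanishes on its real span, so real membership
already forces rational coefficients. -/
lemma exists_combination_of_mem_span (hi : toReal i ∈ span S) :
    ∃ c : (Fin d → ℤ) → ℚ, ∑ s ∈ S, c s = 1 ∧ ∀ k, ∑ s ∈ S, c s * s k = i k :=
  (exists_combination_or_intAffine S i).resolve_right fun ⟨L, hL, h⟩ =>
    h (L.eval_eq_zero_of_mem_span hL hi)

end Rational

/-! ### Valuations -/

section Valuations

variable {d : ℕ} {K : Type*} [Field K] {v : AddValuation K (WithTop ℝ)}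
  {A S F : Finset (Fin d → ℤ)} {p : (Fin d → ℤ) → ℝ} {q : Fin d → ℝ} {i j : Fin d → ℤ}

lemma map_zpow_of_eq {b : K} {r : ℝ} (hb : v b = (r : WithTop ℝ)) (n : ℤ) :
    v (b ^ n) = ((n * r : ℝ) : WithTop ℝ) := by
  have hb0 : b ≠ 0 := v.ne_top_iff.1 (hb ▸ WithTop.coe_ne_top)
  have hnat : ∀ n : ℕ, v (b ^ n) = ((n * r : ℝ) : WithTop ℝ) := fun n => by
    rw [v.map_pow, hb, ← WithTop.coe_nsmul, nsmul_eq_mul]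
  obtain ⟨n, rfl | rfl⟩ := n.eq_nat_or_neg
  · rw [zpow_natCast, hnat]; simp
  · have h : v (b ^ (-(n : ℤ)) * b ^ n) = 0 := by
      rw [zpow_neg, zpow_natCast, inv_mul_cancel₀ (pow_ne_zero _ hb0), v.map_one]
    rw [v.map_mul, hnat] at h
    have ht : v (b ^ (-(n : ℤ))) ≠ ⊤ := v.ne_top_iff.2 (zpow_ne_zero _ hb0)
    lift v (b ^ (-(n : ℤ))) to ℝ using ht with s
    rw [← WithTop.coe_add, ← WithTop.coe_zero, WithTop.coe_inj] at h
    rw [WithTop.coe_inj]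
    push_cast
    linarith

lemma map_prod_zpow {b : Fin d → K} (hb : ∀ k, v (b k) = (q k : WithTop ℝ)) (i : Fin d → ℤ) :
    v (∏ k, b k ^ i k) = (pair i q : WithTop ℝ) := by
  have h : ∀ s : Finset (Fin d),
      v (∏ k ∈ s, b k ^ i k) = ((∑ k ∈ s, (i k : ℝ) * q k : ℝ) : WithTop ℝ) := by
    intro s
    induction s using Finset.induction_on with
    | empty => simp
    | insert k s hk ih =>
      rw [Finset.prod_insert hk, Finset.sum_insert hk, v.map_mul, ih, map_zpow_of_eq (hb k),
        WithTop.coe_add]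
  exact h Finset.univ

/-- A nonzero integer has nonzero residue, so it is a unit of the valuation ring: it and its inverse
both have nonnegative valuation. -/
lemma map_intCast_of_charZero_residueField
    (hres : CharZero (IsLocalRing.ResidueField (AddValuation.toValuation v).valuationSubring))
    {n : ℤ} (hn : n ≠ 0) : v (n : K) = 0 := by
  have hmem : ∀ x : (AddValuation.toValuation v).valuationSubring, (0 : WithTop ℝ) ≤ v (x : K) :=
    fun x => x.2
  have hu : IsUnit (n : (AddValuation.toValuation v).valuationSubring) := by
    rw [← IsLocalRing.residue_ne_zero_iff_isUnit, map_intCast]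
    exact Int.cast_ne_zero.2 hn
  obtain ⟨y, hy⟩ := hu.exists_right_inv
  have h : (n : K) * (y : K) = 1 := by
    have := congrArg (fun z : (AddValuation.toValuation v).valuationSubring => (z : K)) hy
    simpa using this
  have h1 := congrArg v h
  rw [v.map_mul, v.map_one] at h1
  have hn0 : (0 : WithTop ℝ) ≤ v (n : K) := by simpa using hmem n
  refine le_antisymm ?_ hn0
  calc v (n : K) ≤ v (n : K) + v (y : K) := le_add_of_nonneg_right (hmem y)
    _ = 0 := h1

lemma map_ratCast_nonneg [CharZero K] (hv : ∀ n : ℤ, n ≠ 0 → v (n : K) = 0) (c : ℚ) :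
    0 ≤ v (c : K) := by
  rcases eq_or_ne c 0 with rfl | hc
  · simp
  have h : (c : K) * ((c.den : ℤ) : K) = (c.num : K) := by
    exact_mod_cast congrArg (Rat.cast : ℚ → K) (Rat.mul_den_eq_num c)
  have h1 := congrArg v h
  rw [v.map_mul, hv _ (Int.natCast_ne_zero.2 c.den_nz), hv _ (Rat.num_ne_zero.2 hc), add_zero] at h1
  exact h1.ge

/-! ### Singular points as affine relations with prescribed valuations -/

/-- The relations `∑ y_i (1, i) = 0` among the exponents in `A`. -/
def IsRelation (A : Finset (Fin d → ℤ)) (y : (Fin d → ℤ) → K) : Prop :=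
  ∑ i ∈ A, y i = 0 ∧ ∀ k, ∑ i ∈ A, (i k : K) * y i = 0

lemma IsRelation.add_const_mul {y z : (Fin d → ℤ) → K} (hy : IsRelation A y) (hz : IsRelation A z)
    (n : K) : IsRelation A fun i => y i + n * z i := by
  refine ⟨by rw [Finset.sum_add_distrib, ← Finset.mul_sum, hy.1, hz.1, mul_zero, add_zero],
    fun k => ?_⟩
  simp only [mul_add, mul_left_comm _ n, Finset.sum_add_distrib, ← Finset.mul_sum, hy.2 k, hz.2 k,
    mul_zero, add_zero]

lemma IsRelation.sum_eval_mul {y : (Fin d → ℤ) → K} (hy : IsRelation A y) (L : IntAffine d) :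
    ∑ i ∈ A, (L.eval i : K) * y i = 0 := by
  have h : ∀ i, (L.eval i : K) * y i = ∑ k, (L.lin k : K) * ((i k : K) * y i) + L.const * y i := by
    intro i
    rw [IntAffine.eval]
    push_cast
    rw [add_mul, Finset.sum_mul]
    simp only [mul_assoc]
  simp only [h, Finset.sum_add_distrib]
  rw [Finset.sum_comm]
  simp only [← Finset.mul_sum, hy.1, hy.2, mul_zero, Finset.sum_const_zero, add_zero]

/-- The factor `b k` undoes the shift of exponents, so vanishing derivatives become linear equations
in the y_i = a_i b^i. -/
lemma laurentPDeriv_mul {a : (Fin d → ℤ) → K} {b : Fin d → K} (hb : ∀ k, b k ≠ 0) (k : Fin d) :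
    laurentPDeriv A a k b * b k = ∑ i ∈ A, (i k : K) * (a i * ∏ k, b k ^ i k) := by
  rw [laurentPDeriv, Finset.sum_mul]
  refine Finset.sum_congr rfl fun i _ => ?_
  have h : (∏ l, b l ^ (i l - if l = k then 1 else 0)) * b k = ∏ l, b l ^ i l := by
    have e : b k = ∏ l, if l = k then b l else 1 := by simp
    rw [e]
    rw [← Finset.prod_mul_distrib]
    refine Finset.prod_congr rfl fun l _ => ?_
    split_ifs with hl
    · rw [← zpow_add_one₀ (hb l), sub_add_cancel]
    · rw [sub_zero, mul_one]
  rw [mul_assoc, h, mul_assoc]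

lemma exists_relation_of_isSingularPoint (h : IsSingularPoint v A p q) :
    ∃ y : (Fin d → ℤ) → K, IsRelation A y ∧ ∀ i ∈ A, v (y i) = (term p i q : WithTop ℝ) := by
  obtain ⟨-, a, b, ha, hb, h0, h1⟩ := h
  have hb0 : ∀ k, b k ≠ 0 := fun k => v.ne_top_iff.1 (hb k ▸ WithTop.coe_ne_top)
  refine ⟨fun i => a i * ∏ k, b k ^ i k, ⟨h0, fun k => ?_⟩, fun i hi => ?_⟩
  · rw [← laurentPDeriv_mul hb0, h1 k, zero_mul]
  · rw [v.map_mul, ha i hi, map_prod_zpow hb, ← WithTop.coe_add, term]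

lemma isSingularPoint_of_relation (hq : q ∈ tropHypersurface A p)
    (hqv : ∀ k, ∃ x : K, v x = (q k : WithTop ℝ)) {y : (Fin d → ℤ) → K} (hy : IsRelation A y)
    (hyv : ∀ i ∈ A, v (y i) = (term p i q : WithTop ℝ)) : IsSingularPoint v A p q := by
  choose b hb using hqv
  have hb0 : ∀ k, b k ≠ 0 := fun k => v.ne_top_iff.1 (hb k ▸ WithTop.coe_ne_top)
  have hprod : ∀ i : Fin d → ℤ, ∏ k, b k ^ i k ≠ 0 := fun i =>
    Finset.prod_ne_zero_iff.2 fun k _ => zpow_ne_zero _ (hb0 k)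
  have e : ∀ i : Fin d → ℤ, y i / (∏ k, b k ^ i k) * ∏ k, b k ^ i k = y i := fun i =>
    div_mul_cancel₀ _ (hprod i)
  refine ⟨hq, fun i => y i / ∏ k, b k ^ i k, b, fun i hi => ?_, hb, ?_, fun k => ?_⟩
  · have h := congrArg v (e i)
    rw [v.map_mul, hyv i hi, map_prod_zpow hb] at h
    have ht : v (y i / ∏ k, b k ^ i k) ≠ ⊤ := fun ht => by
      rw [ht, top_add] at h
      exact WithTop.coe_ne_top h.symm
    lift v (y i / ∏ k, b k ^ i k) to ℝ using ht with s
    rw [← WithTop.coe_add, WithTop.coe_inj, term] at h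
    rw [WithTop.coe_inj]
    linarith
  · rw [laurentEval]
    simp only [e]
    exact hy.1
  · refine (mul_eq_zero.1 (?_ : _ * b k = 0)).resolve_right (hb0 k)
    rw [laurentPDeriv_mul hb0]
    simp only [e]
    exact hy.2 k

/-- A relation cannot have a unique term of least valuation with `L ≠ 0`. -/
lemma not_isSingularPoint_of_unique_min (hv : ∀ n : ℤ, n ≠ 0 → v (n : K) = 0) (L : IntAffine d)
    (hi : i ∈ A) (hLi : L.eval i ≠ 0)
    (h : ∀ j ∈ A, j ≠ i → L.eval j ≠ 0 → term p i q < term p j q) :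
    ¬ IsSingularPoint v A p q := by
  intro hs
  obtain ⟨y, hy, hyv⟩ := exists_relation_of_isSingularPoint hs
  have hsum := hy.sum_eval_mul L
  rw [← Finset.add_sum_erase _ _ hi] at hsum
  have hval : v (L.eval i * y i) = (term p i q : WithTop ℝ) := by
    rw [v.map_mul, hv _ hLi, zero_add, hyv i hi]
  -- The remaining terms have strictly larger valuation, yet their sum must cancel the one at `i`.
  have hlt : (term p i q : WithTop ℝ) < v (∑ j ∈ A.erase i, (L.eval j : K) * y j) := by
    refine v.map_lt_sum WithTop.coe_ne_top fun j hj => ?_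
    obtain ⟨hji, hj⟩ := Finset.mem_erase.1 hj
    by_cases hL : L.eval j = 0
    · rw [hL, Int.cast_zero, zero_mul, v.map_zero]
      exact WithTop.coe_lt_top _
    · rw [v.map_mul, hv _ hL, zero_add, hyv j hj]
      exact WithTop.coe_lt_coe.2 (h j hj hji hL)
  rw [← eq_neg_iff_add_eq_zero] at hsum
  rw [← v.map_neg, ← hsum, hval] at hlt
  exact lt_irrefl _ hlt

/-- A relation that is supported where the value is at most that at `j`. -/
lemma exists_relation_of_mem_span [CharZero K] (hv : ∀ n : ℤ, n ≠ 0 → v (n : K) = 0)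
    (hj : j ∈ A) (hjv : ∃ x : K, v x = (term p j q : WithTop ℝ)) (hS : S ⊆ A)
    (hle : ∀ i ∈ S, term p i q ≤ term p j q) (hjS : j ∉ S) (hspan : toReal j ∈ span S) :
    ∃ y : (Fin d → ℤ) → K, IsRelation A y ∧ (∀ i ∈ A, (term p i q : WithTop ℝ) ≤ v (y i)) ∧
      v (y j) = (term p j q : WithTop ℝ) := by
  obtain ⟨t, ht⟩ := hjv
  obtain ⟨c, hc1, hc⟩ := exists_combination_of_mem_span hspan
  have hsum : ∀ f : (Fin d → ℤ) → K,
      ∑ i ∈ A, f i * (t * ((if i ∈ S then (c i : K) else 0) - if i = j then 1 else 0)) =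
        t * (∑ i ∈ S, (c i : K) * f i - f j) := by
    intro f
    have e : ∀ i, f i * (t * ((if i ∈ S then (c i : K) else 0) - if i = j then 1 else 0)) =
        t * ((if i ∈ S then (c i : K) * f i else 0) - if i = j then f i else 0) := by
      intro i
      split_ifs <;> ring
    simp only [e]
    rw [← Finset.mul_sum, Finset.sum_sub_distrib, Finset.sum_ite_eq_of_mem' A j f hj,
      Finset.sum_ite_mem, Finset.inter_eq_right.2 hS]
  -- The dependency ∑ c_i e_i - e_j is scaled by `t`, whose valuation is the value at `j`. On `S`
  -- valuations are at least this value, elsewhere the entries vanish.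
  refine ⟨fun i => t * ((if i ∈ S then (c i : K) else 0) - if i = j then 1 else 0),
    ⟨?_, fun k => ?_⟩, fun i _ => ?_, ?_⟩
  · have h := hsum fun _ => 1
    simp only [one_mul, mul_one] at h
    rw [h, ← Rat.cast_sum, hc1, Rat.cast_one, sub_self, mul_zero]
  · rw [hsum fun i => (i k : K)]
    have h : ∑ i ∈ S, (c i : K) * (i k : K) = (j k : K) := by
      exact_mod_cast congrArg (Rat.cast : ℚ → K) (hc k)
    rw [h, sub_self, mul_zero]
  · by_cases hij : i = j
    · subst hij
      simp [hjS, ht]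
    · by_cases hi : i ∈ S
      · simp only [hi, hij, if_true, if_false, sub_zero]
        rw [v.map_mul, ht]
        calc (term p i q : WithTop ℝ) ≤ term p j q := WithTop.coe_le_coe.2 (hle i hi)
          _ ≤ _ := le_add_of_nonneg_right (map_ratCast_nonneg hv _)
      · simp [hi, hij]
  · simp [hjS, ht]

/-- Of the elements `y + n z` with `n ∈ ℕ`, at most one has valuation greater than `g`. -/
lemma subsingleton_lt_map_add_mul (hv : ∀ n : ℤ, n ≠ 0 → v (n : K) = 0) {y z : K}
    {g : WithTop ℝ} (h : v y = g ∨ v z = g) :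
    {n : ℕ | g < v (y + n * z)}.Subsingleton := by
  intro n hn m hm
  by_contra hne
  have hn : g < v (y + n * z) := hn
  have hm : g < v (y + m * z) := hm
  have hcast : ((n : ℤ) - m) ≠ 0 := by omega
  -- Subtracting the two elements leaves (n - m) z, and n - m has valuation 0. Hence `z`, and then
  -- `y`, has valuation above `g`.
  have hzlt : g < v z := by
    have e : (((n : ℤ) - m : ℤ) : K) * z = (y + n * z) + -(y + m * z) := by
      push_cast; ring
    have h1 := v.map_lt_add hn (by rwa [v.map_neg])
    rwa [← e, v.map_mul, hv _ hcast, zero_add] at h1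
  have hylt : g < v y := by
    have hnz : g < v (n * z) := by
      rcases Nat.eq_zero_or_pos n with rfl | hpos
      · simpa using hzlt.trans_le le_top
      · have := hv n (by omega)
        rw [Int.cast_natCast] at this
        rwa [v.map_mul, this, zero_add]
    have h1 := v.map_lt_add hn (by rwa [v.map_neg] : g < v (-(n * z)))
    rwa [add_neg_cancel_right] at h1
  rcases h with h | h
  · exact hylt.ne' h
  · exact hzlt.ne' h

/-- Relations that attain the prescribed valuations one at a time can be combined. -/
lemma exists_relation_of_forall_exists (hv : ∀ n : ℤ, n ≠ 0 → v (n : K) = 0)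
    {g : (Fin d → ℤ) → WithTop ℝ}
    (h : ∀ j ∈ A, ∃ y : (Fin d → ℤ) → K, IsRelation A y ∧ (∀ i ∈ A, g i ≤ v (y i)) ∧
      v (y j) = g j) :
    ∃ y : (Fin d → ℤ) → K, IsRelation A y ∧ ∀ i ∈ A, v (y i) = g i := by
  have key : ∀ T ⊆ A, ∃ y : (Fin d → ℤ) → K, IsRelation A y ∧ (∀ i ∈ A, g i ≤ v (y i)) ∧
      ∀ i ∈ T, v (y i) = g i := by
    intro T
    induction T using Finset.induction_on with
    | empty =>
      intro _
      exact ⟨0, ⟨by simp, by simp⟩, by simp, by simp⟩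
    | insert j T hj ih =>
      intro hT
      obtain ⟨y, hy, hyle, hyeq⟩ := ih ((Finset.subset_insert _ _).trans hT)
      obtain ⟨z, hz, hzle, hzeq⟩ := h j (hT (Finset.mem_insert_self _ _))
      -- Each exponent treated so far, and `j`, excludes at most one multiplier `n`.
      have hfin : (⋃ i ∈ insert j T, {n : ℕ | g i < v (y i + n * z i)}).Finite := by
        refine (insert j T).finite_toSet.biUnion fun i hi => Set.Subsingleton.finite ?_
        refine subsingleton_lt_map_add_mul hv ?_
        rcases Finset.mem_insert.1 hi with rfl | hi
        · exact Or.inr hzeq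
        · exact Or.inl (hyeq i hi)
      obtain ⟨n, hn⟩ := hfin.exists_notMem
      have hle : ∀ i ∈ A, g i ≤ v (y i + n * z i) := by
        intro i hi
        refine v.map_le_add (hyle i hi) ?_
        rcases Nat.eq_zero_or_pos n with rfl | hpos
        · simp
        · have := hv n (by omega)
          rw [Int.cast_natCast] at this
          rw [v.map_mul, this, zero_add]
          exact hzle i hi
      refine ⟨fun i => y i + n * z i, hy.add_const_mul hz n, hle, fun i hi => ?_⟩
      refine le_antisymm ?_ (hle i (hT hi))
      by_contra hlt
      exact hn (Set.mem_biUnion hi (not_le.1 hlt))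
  obtain ⟨y, hy, -, he⟩ := key A subset_rfl
  exact ⟨y, hy, he⟩

/-! ### The algorithm -/

lemma exists_algorithmReturns (hA : affDim A = d) (hq : q ∈ tropHypersurface A p) :
    ∃ out, AlgorithmReturns A p q out := by
  obtain ⟨r, hlt, hr⟩ := exists_flag_length hA hq
  have pyr : ∀ F : Finset (Fin d → ℤ), IsPyramid F → ∃ out, RunFrom A p q F out := by
    rintro F ⟨i, hi, hspan⟩
    obtain ⟨L, h0, h1⟩ := exists_intAffine_of_not_mem_span hspan
    exact ⟨_, RunFrom.regular F i L hi hspan h0 h1⟩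
  -- Induction runs backwards from the index `r`, where the procedure must stop.
  have key : ∀ m ≤ r, ∃ out, RunFrom A p q (flag A p q (r - m)) out := by
    intro m
    induction m with
    | zero =>
      intro _
      by_cases hp : IsPyramid (flag A p q (r - 0))
      · exact pyr _ hp
      · exact ⟨_, RunFrom.singular _ hp hr⟩
    | succ m ih =>
      intro hm
      by_cases hp : IsPyramid (flag A p q (r - (m + 1)))
      · exact pyr _ hp
      · obtain ⟨out, hout⟩ := ih (by omega)
        refine ⟨out, RunFrom.step _ out hp (hlt _ (by omega)) ?_⟩
        rw [← flag, show (r - (m + 1)).succ = r - m by omega]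
        exact hout
  simpa [AlgorithmReturns, flag] using key r le_rfl

/-- The run checks the members up to the first spanning one, after which the flag is constant. -/
lemma not_isPyramid_of_algorithmReturns_none (hq : q ∈ tropHypersurface A p)
    (h : AlgorithmReturns A p q none) (n : ℕ) : ¬ IsPyramid (flag A p q n) := by
  have key : ∀ F out, RunFrom A p q F out → out = none → ∀ m, F = flag A p q m →
      ∀ n, m ≤ n → ¬ IsPyramid (flag A p q n) := by
    intro F out hrun
    induction hrun with
    | regular F i L => intro h; cases h
    | singular F hF hdim =>
      rintro - m rfl n hn
      rwa [flag_eq_of_affDim_eq hq hdim hn]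
    | step F out hF hdim hrun ih =>
      rintro h m rfl n hn
      rcases hn.eq_or_lt with rfl | hn
      · exact hF
      · exact ih h (m + 1) rfl n hn
  exact key _ _ h rfl 0 rfl n (Nat.zero_le n)

lemma exists_flag_of_algorithmReturns_some {L : IntAffine d}
    (h : AlgorithmReturns A p q (some L)) :
    ∃ n, (∀ m < n, ¬ IsPyramid (flag A p q m)) ∧ ∃ i ∈ flag A p q n,
      toReal i ∉ span ((flag A p q n).erase i) ∧ (∀ j ∈ (flag A p q n).erase i, L.eval j = 0) ∧
      L.eval i ≠ 0 := by
  have key : ∀ F out, RunFrom A p q F out → out = some L → ∀ m, F = flag A p q m →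
      (∀ l < m, ¬ IsPyramid (flag A p q l)) → ∃ n, (∀ m < n, ¬ IsPyramid (flag A p q m)) ∧
      ∃ i ∈ flag A p q n, toReal i ∉ span ((flag A p q n).erase i) ∧
      (∀ j ∈ (flag A p q n).erase i, L.eval j = 0) ∧ L.eval i ≠ 0 := by
    intro F out hrun
    induction hrun with
    | regular F i L' hi hspan hzero hne =>
      rintro h m rfl hm
      cases h
      exact ⟨m, hm, i, hi, hspan, hzero, hne⟩
    | singular F hF hdim => intro h; cases h
    | step F out hF hdim hrun ih =>
      rintro h m rfl hm
      refine ih h (m + 1) rfl fun l hl => ?_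
      rcases (Nat.lt_succ_iff.1 hl).eq_or_lt with rfl | hl
      · exact hF
      · exact hm l hl
  exact key _ _ h rfl 0 rfl fun l hl => absurd hl (Nat.not_lt_zero l)

/-- If the algorithm returns `L`, then one exponent of the Euler derivative is the unique
minimizer. -/
lemma exists_unique_min_of_algorithmReturns_some {L : IntAffine d}
    (h : AlgorithmReturns A p q (some L)) :
    ∃ i ∈ A, L.eval i ≠ 0 ∧ ∀ j ∈ A, j ≠ i → L.eval j ≠ 0 → term p i q < term p j q := by
  obtain ⟨n, hnp, i, hi, hspan, hzero, hne⟩ := exists_flag_of_algorithmReturns_some h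
  rw [flag_eq_chain] at hi hspan hzero
  -- The apex is new in this member: the preceding one is not a pyramid, so an older `i` would lie
  -- in the span of its other points.
  have hprev : i ∉ chain A p q n := by
    intro hin
    cases n with
    | zero => simp [chain] at hin
    | succ n =>
      refine hnp n n.lt_succ_self ⟨i, by rwa [flag_eq_chain], fun hs => hspan ?_⟩
      rw [flag_eq_chain] at hs
      exact span_mono (Finset.erase_subset_erase i (chain_mono (Nat.le_succ _))) hs
  have hmin := (mem_chain_succ.1 hi).resolve_left hprev
  refine ⟨i, chain_subset _ hi, hne, fun j hj hji hLj => ?_⟩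
  -- `L` vanishes on the preceding member, hence on its span. A tie with `i` would put `j` into the
  -- same member, where `L` vanishes away from `i`.
  have hjo : j ∈ outside A (chain A p q n) := by
    refine mem_outside.2 ⟨hj, fun hs => hLj (L.eval_eq_zero_of_mem_span (fun s hs => ?_) hs)⟩
    exact hzero s (Finset.mem_erase.2 ⟨fun e => hprev (e ▸ hs), chain_mono (Nat.le_succ _) hs⟩)
  refine lt_of_le_of_ne ((mem_minimizers.1 hmin).2 j hjo) fun e => hLj (hzero j ?_)
  rw [Finset.mem_erase]
  exact ⟨hji, mem_chain_succ.2 (Or.inr ((mem_minimizers_iff_of_mem hmin hjo).2 e))⟩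

lemma not_mem_tropHypersurface_of_unique_min (hi : i ∈ S)
    (h : ∀ j ∈ S, j ≠ i → term p i q < term p j q) : q ∉ tropHypersurface S p := by
  have key : ∀ j ∈ minimizers S p q, j = i := by
    intro j hj
    by_contra hne
    exact absurd ((mem_minimizers.1 hj).2 i hi) (not_le.2 (h j (minimizers_subset hj) hne))
  rintro ⟨j, hj, k, hk, hne⟩
  exact hne ((key j hj).trans (key k hk).symm)

/-- If no member of the flag is a pyramid, then each exponent is in the affine span of others with
at most the same value. -/
lemma exists_subset_span_of_not_isPyramid (hA : affDim A = d) (hq : q ∈ tropHypersurface A p)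
    (h : ∀ n, ¬ IsPyramid (flag A p q n)) (hj : j ∈ A) :
    ∃ S ⊆ A, (∀ i ∈ S, term p i q ≤ term p j q) ∧ j ∉ S ∧ toReal j ∈ span S := by
  obtain ⟨n, hn, hn'⟩ := exists_chain_index hA hq j
  have hjo : j ∈ outside A (chain A p q n) := mem_outside.2 ⟨hj, hn⟩
  -- `S` is the first member whose span contains `j`, without `j`; not being a pyramid, the member
  -- keeps `j` in the span after the removal.
  refine ⟨(chain A p q (n + 1)).erase j, (Finset.erase_subset _ _).trans (chain_subset _),
    fun i hi => ?_, Finset.notMem_erase _ _, ?_⟩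
  · rcases mem_chain_succ.1 (Finset.mem_of_mem_erase hi) with hi | hi
    · exact (term_lt_term_of_mem_chain hi hj hn).le
    · exact (mem_minimizers.1 hi).2 j hjo
  · by_cases hjc : j ∈ chain A p q (n + 1)
    · by_contra hs
      have := h n
      rw [flag_eq_chain] at this
      exact this ⟨j, hjc, hs⟩
    · rwa [Finset.erase_eq_of_notMem hjc]

lemma exists_map_eq_term (hpv : ∀ i ∈ A, ∃ x : K, v x = (p i : WithTop ℝ))
    (hqv : ∀ k, ∃ x : K, v x = (q k : WithTop ℝ)) (hi : i ∈ A) :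
    ∃ x : K, v x = (term p i q : WithTop ℝ) := by
  obtain ⟨a, ha⟩ := hpv i hi
  choose b hb using hqv
  exact ⟨a * ∏ k, b k ^ i k, by rw [v.map_mul, ha, map_prod_zpow hb, ← WithTop.coe_add, term]⟩

lemma isSingularPoint_of_not_isPyramid [CharZero K] (hv : ∀ n : ℤ, n ≠ 0 → v (n : K) = 0)
    (hA : affDim A = d) (hq : q ∈ tropHypersurface A p)
    (hpv : ∀ i ∈ A, ∃ x : K, v x = (p i : WithTop ℝ))
    (hqv : ∀ k, ∃ x : K, v x = (q k : WithTop ℝ)) (h : ∀ n, ¬ IsPyramid (flag A p q n)) :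
    IsSingularPoint v A p q := by
  obtain ⟨y, hy, hyv⟩ := exists_relation_of_forall_exists (v := v) (A := A)
    (g := fun i => (term p i q : WithTop ℝ)) hv fun j hj => by
      obtain ⟨S, hS, hle, hjS, hspan⟩ := exists_subset_span_of_not_isPyramid hA hq h hj
      exact exists_relation_of_mem_span hv hj (exists_map_eq_term hpv hqv hj) hS hle hjS hspan
  exact isSingularPoint_of_relation hq hqv hy hyv

/-- A run uses the point only through the members of its flag. -/
lemma algorithmReturns_congr {q' : Fin d → ℝ} (h : flag A p q' = flag A p q) {out : Option (IntAffine d)}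
    (hrun : AlgorithmReturns A p q out) : AlgorithmReturns A p q' out := by
  have key : ∀ F out, RunFrom A p q F out → ∀ m, F = flag A p q m →
      RunFrom A p q' F out := by
    intro F out hrun
    induction hrun with
    | regular F i L hi hspan hzero hne => exact fun _ _ => RunFrom.regular F i L hi hspan hzero hne
    | singular F hF hdim => exact fun _ _ => RunFrom.singular F hF hdim
    | step F out hF hdim hrun ih =>
      rintro m rfl
      refine RunFrom.step _ out hF hdim ?_
      have := ih (m + 1) rfl
      rwa [← flag, ← h, flag, h] at this
  have := key _ _ hrun 0 rfl
  have e : minimizers A p q' = minimizers A p q := congrFun h 0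
  rwa [AlgorithmReturns, e]

end Valuations

end TropSing

end

/-! ### The main theorem -/

open TropSing

theorem mainTheorem7 {d : ℕ} (A : Finset (Fin d → ℤ)) (hA : TropSing.affDim A = d)
    {K : Type*} [Field K] [IsAlgClosed K] [CharZero K] (v : AddValuation K (WithTop ℝ))
    (hv : ∃ x : K, v x ≠ 0 ∧ v x ≠ ⊤)
    (hres : CharZero (IsLocalRing.ResidueField (AddValuation.toValuation v).valuationSubring))
    (p : (Fin d → ℤ) → ℝ) :
    -- the flags are strictly increasing until they span everything
    (∀ q ∈ TropSing.tropHypersurface A p, ∃ r : ℕ,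
      (∀ ℓ < r, TropSing.flag A p q ℓ ⊂ TropSing.flag A p q (ℓ + 1) ∧
        TropSing.affDim (TropSing.flag A p q ℓ) < d) ∧
      TropSing.affDim (TropSing.flag A p q r) = d ∧
      ∀ ℓ, r ≤ ℓ → TropSing.flag A p q ℓ = TropSing.flag A p q r) ∧
    -- finitely many relatively open polyhedral cells
    (TropSing.weightClasses A p).Finite ∧
    (∀ C ∈ TropSing.weightClasses A p,
      TropSing.IsRelOpenCell C ∧ intrinsicInterior ℝ (closure C) = C) ∧
    -- their closures form a polyhedral complex with support `T(f)` that refines the dual structure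
    TropSing.IsPolyhedralComplex (closure '' TropSing.weightClasses A p) ∧
    ⋃₀ (closure '' TropSing.weightClasses A p) = TropSing.tropHypersurface A p ∧
    ⋃₀ TropSing.hypersurfaceCells A p = TropSing.tropHypersurface A p ∧
    TropSing.Refines (closure '' TropSing.weightClasses A p) (TropSing.hypersurfaceCells A p) ∧
    (∀ q ∈ TropSing.tropHypersurface A p,
      TropSing.weightClass A p q ⊆
        intrinsicInterior ℝ (TropSing.dualCell A p (TropSing.minimizers A p q))) ∧
    -- each cell is singular or regular, and the algorithm at any of its points decides which
    ((∀ i ∈ A, ∃ x : K, v x = (p i : WithTop ℝ)) → ∀ C ∈ TropSing.weightClasses A p,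
      ((∀ q ∈ C, (∀ k, ∃ x : K, v x = (q k : WithTop ℝ)) → TropSing.IsSingularPoint v A p q) ∨
        (∀ q ∈ C, ¬ TropSing.IsSingularPoint v A p q)) ∧
      ∀ q ∈ C,
        (∃ out, TropSing.AlgorithmReturns A p q out) ∧
        (TropSing.AlgorithmReturns A p q none →
          ∀ q' ∈ C, (∀ k, ∃ x : K, v x = (q' k : WithTop ℝ)) →
            TropSing.IsSingularPoint v A p q') ∧
        ∀ L, TropSing.AlgorithmReturns A p q (some L) →
          (∀ q' ∈ C, ¬ TropSing.IsSingularPoint v A p q') ∧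
          (TropSing.eulerSupport A L).Nonempty ∧
          q ∉ TropSing.tropHypersurface (TropSing.eulerSupport A L) p) := by
  have hvz : ∀ n : ℤ, n ≠ 0 → v (n : K) = 0 := fun _ hn =>
    map_intCast_of_charZero_residueField hres hn
  refine ⟨fun q hq => ?_, finite_weightClasses hA, ?_,
    isPolyhedralComplex_closure_weightClasses hA, sUnion_closure_weightClasses,
    sUnion_hypersurfaceCells, refines_hypersurfaceCells,
    fun q _ => weightClass_subset_intrinsicInterior, ?_⟩
  · obtain ⟨r, hlt, hr⟩ := exists_flag_length hA hq
    exact ⟨r, fun n hn => ⟨flag_ssubset_of_affDim_lt hA (hlt n hn), hlt n hn⟩, hr,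
      fun n hn => flag_eq_of_affDim_eq hq hr hn⟩
  · rintro _ ⟨q, hq, rfl⟩
    refine ⟨⟨relPoly p (flagRel A p q), isRationalPolyhedron_relPoly, ?_⟩,
      intrinsicInterior_closure_weightClass hA hq⟩
    rw [← closure_weightClass hA hq, intrinsicInterior_closure_weightClass hA hq]
  · rintro hpv _ ⟨q₀, hq₀, rfl⟩
    have hnone : ∀ q ∈ weightClass A p q₀, AlgorithmReturns A p q none →
        ∀ q' ∈ weightClass A p q₀, (∀ k, ∃ x : K, v x = (q' k : WithTop ℝ)) →
          IsSingularPoint v A p q' := fun q hq h q' hq' hqv =>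
      isSingularPoint_of_not_isPyramid hvz hA hq'.1 hpv hqv
        (not_isPyramid_of_algorithmReturns_none hq'.1
          (algorithmReturns_congr (hq'.2.trans hq.2.symm) h))
    have hsome : ∀ q ∈ weightClass A p q₀, ∀ L, AlgorithmReturns A p q (some L) →
        ∀ q' ∈ weightClass A p q₀, ¬ IsSingularPoint v A p q' := by
      intro q hq L h q' hq'
      obtain ⟨i, hi, hne, hmin⟩ := exists_unique_min_of_algorithmReturns_some
        (algorithmReturns_congr (hq'.2.trans hq.2.symm) h)
      exact not_isSingularPoint_of_unique_min hvz L hi hne hmin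
    refine ⟨?_, fun q hq => ⟨exists_algorithmReturns hA hq.1, hnone q hq, fun L h => ?_⟩⟩
    · obtain ⟨_ | L, h⟩ := exists_algorithmReturns hA hq₀
      · exact Or.inl (hnone q₀ (mem_weightClass_self hq₀) h)
      · exact Or.inr (hsome q₀ (mem_weightClass_self hq₀) L h)
    · obtain ⟨i, hi, hne, hmin⟩ := exists_unique_min_of_algorithmReturns_some h
      have hi' : i ∈ eulerSupport A L := Finset.mem_filter.2 ⟨hi, hne⟩
      refine ⟨hsome q hq L h, ⟨i, hi'⟩, not_mem_tropHypersurface_of_unique_min hi' ?_⟩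
      exact fun j hj hji => hmin j (Finset.mem_filter.1 hj).1 hji (Finset.mem_filter.1 hj).2
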